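/- **Setting.** Let $n\ge 2$, $k\ge 1$ be integers, $m=kn$, $a>0$, and let $(\Omega,\mathcal F,\mathbb P)$ be a probability space. A random variable is *super-Pareto* if it is distributed as $f(Y)$, where $\mathbb P(Y\le x)=1-1/x$ for $x\ge 1$ and $f$ is increasing (non-strictly), convex and non-constant. Random variables $X_1,\dots,X_n$ are *weakly negatively associated* if $\mathbb P(\mathbf X_{-i}\in S\mid X_i\le x)\le \mathbb P(\mathbf X_{-i}\in S)$ for all $i$, all (measurable) decreasing sets $S\subseteq\mathbb R^{n-1}$ and all $x$ with $\mathbb P(X_i\le x)>0$, where $\mathbf X_{-i}=(X_j)_{j\ne i}$. Let $X_1,\dots,X_n$ be weakly negatively associated and identically distributed super-Pareto random variables with a continuous distribution function, $\mathbf X=(X_1,\dots,X_n)$, and let $X$ be a random variable with the same distribution as $X_1$. Let $\mathcal X$ be a set of random variables that contains $\mathbf w\cdot\mathbf X+c$ for all $\mathbf w\in\mathbb R_+^n$, $c\in\mathbb R$, and every random variable distributed as $\boldsymbol\theta\cdot\mathbf X$ for some $\boldsymbol\theta\in[0,1]^n$ with $\sum_i\theta_i=1$. Let $\rho_I,\rho_E:\mathcal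 X\to\mathbb R$ be mildly monotone distortion risk measures, that is: each is of the form $$\rho(Y)=\int_{-\infty}^0\big(h(\mathbb P(Y>x))-1\big)\,dx+\int_0^\infty h(\mathbb P(Y>x))\,dx,$$ both integrals being finite on $\mathcal X$, for some increasing $h:[0,1]\to[0,1]$ with $h(0)=0$, $h(1)=1$; and for $Y,Z\in\mathcal X$, $\rho(Y)\le\rho(Z)$ if $\mathbb P(Y>x)\le\mathbb P(Z>x)$ for all $x$, and $\rho(Y)<\rho(Z)$ if $\mathbb P(Y<Z)=1$. Let $c_I,c_E:\mathbb R\to[0,\infty)$ be strictly convex, zero at $0$, and continuously differentiable except possibly at $0$. Put $L_E(b)=c_E'(b)+\rho_E(X)$ and $L_I(b)=c_I'(b)+\rho_I(X)$ for $b\neq0$, $L_E(0)=c_{E+}'(0)+\rho_E(X)$, and $L_I^{\pm}(0)=c_{I\pm}'(0)+\rho_I(X)$, where $c'_{\pm}$ are the one-sided derivatives. There are $n$ internal agents, agent $i$ having initial exposure $\mathbf a^i=a\,\mathbf e_i$ ($\mathbf e_i$ the $i$th unit vector of $\mathbb R^n$), and $m=kn$ external agents without initial losses. Write $\|\mathbf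 x\|=\sum_j|x_j|$. A tuple $\mathcal E=(\mathbf p,\mathbf w^{1},\dots,\mathbf w^{n},\mathbf u^{1},\dots,\mathbf u^{m})\in(\mathbb R_+^n)^{n+m+1}$ is an *equilibrium* if each $\mathbf w^i$ minimizes $\mathbf w\mapsto\rho_I\big(\mathbf w\cdot\mathbf X-(\mathbf w-\mathbf a^i)\cdot\mathbf p\big)+c_I(\|\mathbf w\|-\|\mathbf a^i\|)$ over $\mathbb R_+^n$, each $\mathbf u^j$ minimizes $\mathbf u\mapsto\rho_E(\mathbf u\cdot\mathbf X-\mathbf u\cdot\mathbf p)+c_E(\|\mathbf u\|)$ over $\mathbb R_+^n$, and $\sum_{i}\mathbf w^i+\sum_j\mathbf u^j=\sum_i\mathbf a^i$. **Theorem.** Let $\mathcal E=(\mathbf p,\mathbf w^{1},\dots,\mathbf w^{n},\mathbf u^{1},\dots,\mathbf u^{m})$ be a tuple with $\mathbf p\in\mathbb R_+^n$ and $\mathbf w^i,\mathbf u^j\in\mathbb R^n$. (i) Suppose $L_E(a/k)<L_I(-a)$. Then $\mathcal E$ is an equilibrium if and only if $\mathbf p=(p,\dots,p)$ with $p=L_E(a/k)$,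 $(\mathbf u^1,\dots,\mathbf u^m)$ is a permutation of $\frac ak(\mathbf e_{\lceil 1/k\rceil},\dots,\mathbf e_{\lceil m/k\rceil})$, and $\mathbf w^1=\dots=\mathbf w^n=\mathbf 0$. (ii) Suppose $L_E(a/k)\ge L_I(-a)$ and $L_E(0)<L_I^-(0)$. Then the equation $L_E(u)=L_I(-ku)$ has a unique solution $u^*\in(0,a/k]$, and $\mathcal E$ is an equilibrium if and only if $\mathbf p=(p,\dots,p)$ with $p=L_E(u^*)$, $(\mathbf u^1,\dots,\mathbf u^m)=u^*(\mathbf e_{k_1},\dots,\mathbf e_{k_m})$ and $(\mathbf w^1,\dots,\mathbf w^n)=(a-ku^*)(\mathbf e_{\ell_1},\dots,\mathbf e_{\ell_n})$ for some $k_1,\dots,k_m,\ell_1,\dots,\ell_n\in\{1,\dots,n\}$ such that $u^*\,\#\{j:k_j=s\}+(a-ku^*)\,\#\{i:\ell_i=s\}=a$ for each $s\in\{1,\dots,n\}$. Moreover, if $u^*<a/(2k)$, then $\mathcal E$ is an equilibrium if and only if $\mathbf p=(p,\dots,p)$ with $p=L_E(u^*)$, $(\mathbf u^1,\dots,\mathbf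 u^m)$ is a permutation of $u^*(\mathbf e_{\lceil 1/k\rceil},\dots,\mathbf e_{\lceil m/k\rceil})$, and $(\mathbf w^1,\dots,\mathbf w^n)$ is a permutation of $(a-ku^*)(\mathbf e_1,\dots,\mathbf e_n)$. (iii) Suppose $L_E(0)\ge L_I^-(0)$. Then $\mathcal E$ is an equilibrium if and only if $\mathbf p=(p,\dots,p)$ with $p\in[L_I^-(0),\min\{L_E(0),L_I^+(0)\}]$, $\mathbf u^1=\dots=\mathbf u^m=\mathbf 0$, and $(\mathbf w^1,\dots,\mathbf w^n)$ is a permutation of $a(\mathbf e_1,\dots,\mathbf e_n)$. -/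

import Mathlib

open Set MeasureTheory ProbabilityTheory

namespace SuperParetoMarket

noncomputable section

/-! ### Losses -/

/-- `Y` is super-Pareto: it has the law of `f(Z)` with `Z ~ Pareto(1)`, i.e. `P(Z ≤ x) = 1 - 1/x`
for `x ≥ 1`, and `f` increasing (in the wide sense), convex and non-constant on `[1, ∞)`. -/
def IsSuperPareto {Ω : Type*} [MeasurableSpace Ω] (μ : Measure Ω) (Y : Ω → ℝ) : Prop :=
  ∃ f : ℝ → ℝ, MonotoneOn f (Ici 1) ∧ ConvexOn ℝ (Ici 1) f ∧
    (∃ x ∈ Ici (1 : ℝ), ∃ y ∈ Ici (1 : ℝ), f x ≠ f y) ∧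
    μ.map Y = (paretoMeasure 1 1).map f

/-- Weak negative association: `P(X₋ᵢ ∈ S | Xᵢ ≤ x) ≤ P(X₋ᵢ ∈ S)` for every index `i`, every
(measurable) decreasing set `S` and every `x` with `P(Xᵢ ≤ x) > 0`. -/
def WeaklyNegativelyAssociated {Ω : Type*} [MeasurableSpace Ω] (μ : Measure Ω) {n : ℕ}
    (X : Fin n → Ω → ℝ) : Prop :=
  ∀ (i : Fin n) (S : Set ({j : Fin n // j ≠ i} → ℝ)) (x : ℝ),
    IsLowerSet S → MeasurableSet S → 0 < μ {ω | X i ω ≤ x} →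
      (ProbabilityTheory.cond μ {ω | X i ω ≤ x})
          {ω | (fun j : {j : Fin n // j ≠ i} => X j ω) ∈ S}
        ≤ μ {ω | (fun j : {j : Fin n // j ≠ i} => X j ω) ∈ S}

/-! ### Risk measures -/

/-- `ρ` is, on `𝒳`, the (real-valued) distortion risk measure of some distortion function `h`. -/
def IsDistortionRiskMeasure {Ω : Type*} [MeasurableSpace Ω] (μ : Measure Ω)
    (𝒳 : Set (Ω → ℝ)) (ρ : (Ω → ℝ) → ℝ) : Prop :=
  ∃ h : ℝ → ℝ, MonotoneOn h (Icc 0 1) ∧ MapsTo h (Icc 0 1) (Icc 0 1) ∧ h 0 = 0 ∧ h 1 = 1 ∧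
    ∀ Y ∈ 𝒳,
      IntegrableOn (fun x : ℝ => h (μ.real {ω | x < Y ω}) - 1) (Iic 0) ∧
      IntegrableOn (fun x : ℝ => h (μ.real {ω | x < Y ω})) (Ioi 0) ∧
      ρ Y = (∫ x in Iic (0 : ℝ), (h (μ.real {ω | x < Y ω}) - 1))
          + ∫ x in Ioi (0 : ℝ), h (μ.real {ω | x < Y ω})

/-- Weak monotonicity: `ρ` respects first-order stochastic dominance on `𝒳`. -/
def WeaklyMonotone {Ω : Type*} [MeasurableSpace Ω] (μ : Measure Ω)
    (𝒳 : Set (Ω → ℝ)) (ρ : (Ω → ℝ) → ℝ) : Prop :=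
  ∀ Y ∈ 𝒳, ∀ Z ∈ 𝒳, (∀ x : ℝ, μ {ω | x < Y ω} ≤ μ {ω | x < Z ω}) → ρ Y ≤ ρ Z

/-- Mild monotonicity: weak monotonicity, and `ρ(Y) < ρ(Z)` whenever `P(Y < Z) = 1`. -/
def MildlyMonotone {Ω : Type*} [MeasurableSpace Ω] (μ : Measure Ω)
    (𝒳 : Set (Ω → ℝ)) (ρ : (Ω → ℝ) → ℝ) : Prop :=
  WeaklyMonotone μ 𝒳 ρ ∧ ∀ Y ∈ 𝒳, ∀ Z ∈ 𝒳, (∀ᵐ ω ∂μ, Y ω < Z ω) → ρ Y < ρ Z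

/-! ### Costs and marginal costs -/

/-- A non-negative, strictly convex cost function on `ℝ`, vanishing at `0` and continuously
differentiable except possibly at `0`. -/
def IsCostFunction (c : ℝ → ℝ) : Prop :=
  (∀ x, 0 ≤ c x) ∧ c 0 = 0 ∧ StrictConvexOn ℝ univ c ∧ ContDiffOn ℝ 1 c {0}ᶜ

/-- `L(b) = c'(b) + r`, for `b ≠ 0`; here `r` is the risk of one unit of loss. -/
def marginal (c : ℝ → ℝ) (r b : ℝ) : ℝ := deriv c b + r

/-- `L⁺(0) = c'₊(0) + r`, with the right derivative of `c` at `0`. -/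
def marginalRightZero (c : ℝ → ℝ) (r : ℝ) : ℝ := derivWithin c (Ioi 0) 0 + r

/-- `L⁻(0) = c'₋(0) + r`, with the left derivative of `c` at `0`. -/
def marginalLeftZero (c : ℝ → ℝ) (r : ℝ) : ℝ := derivWithin c (Iio 0) 0 + r

/-! ### The market -/

/-- `w · x = ∑ⱼ wⱼ xⱼ`. -/
def dot {n : ℕ} (w x : Fin n → ℝ) : ℝ := ∑ j, w j * x j

/-- `‖w‖ = ∑ⱼ |wⱼ|`. -/
def l1norm {n : ℕ} (w : Fin n → ℝ) : ℝ := ∑ j, |w j|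

/-- The exposure vector `b eᵢ`. -/
def unitExposure {n : ℕ} (b : ℝ) (i : Fin n) : Fin n → ℝ := Pi.single i b

/-- The loss `w · X - (w - aⁱ) · p` of internal agent `i`, whose initial exposure is
`aⁱ = a eᵢ`. -/
def internalLoss {Ω : Type*} {n : ℕ} (X : Fin n → Ω → ℝ) (a : ℝ) (i : Fin n)
    (w p : Fin n → ℝ) : Ω → ℝ :=
  fun ω => dot w (fun j => X j ω) - dot (w - unitExposure a i) p

/-- The loss `u · X - u · p` of an external agent. -/
def externalLoss {Ω : Type*} {n : ℕ} (X : Fin n → Ω → ℝ) (u p : Fin n → ℝ) : Ω → ℝ :=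
  fun ω => dot u (fun j => X j ω) - dot u p

/-- `(p, w¹, …, wⁿ, u¹, …, uᵐ)` is an equilibrium of the market with `n` internal agents (initial
exposures `a eᵢ`, risk measure `ρI`, cost `cI`) and `m` external agents (no initial losses, risk
measure `ρE`, cost `cE`): all vectors are non-negative, every agent minimizes risk plus cost over
`ℝ₊ⁿ` at the price vector `p`, and the market clears. -/
structure IsEquilibrium {Ω : Type*} {n m : ℕ} (X : Fin n → Ω → ℝ)
    (ρI ρE : (Ω → ℝ) → ℝ) (cI cE : ℝ → ℝ) (a : ℝ)
    (p : Fin n → ℝ) (w : Fin n → Fin n → ℝ) (u : Fin m → Fin n → ℝ) : Prop where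
  price_nonneg : 0 ≤ p
  internal_nonneg : ∀ i, 0 ≤ w i
  external_nonneg : ∀ j, 0 ≤ u j
  internal_optimal : ∀ i, IsMinOn
    (fun v : Fin n → ℝ =>
      ρI (internalLoss X a i v p) + cI (l1norm v - l1norm (unitExposure a i)))
    {v | 0 ≤ v} (w i)
  external_optimal : ∀ j, IsMinOn
    (fun v : Fin n → ℝ => ρE (externalLoss X v p) + cE (l1norm v))
    {v | 0 ≤ v} (u j)
  clearance : ∑ i, w i + ∑ j, u j = ∑ i : Fin n, unitExposure a i

/-- `x` is a permutation of the tuple `y`. -/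
def IsPermutationOf {ι α : Type*} (x y : ι → α) : Prop :=
  ∃ σ : Equiv.Perm ι, ∀ i, x i = y (σ i)

/-- The index `⌈j/k⌉ ∈ {1, …, n}` of `j ∈ {1, …, kn}`. As `Fin` counts from `0`, it reads
`⌊j/k⌋ ∈ {0, …, n-1}` for `j ∈ {0, …, kn-1}`. -/
def blockIndex {k n : ℕ} (j : Fin (k * n)) : Fin n :=
  ⟨(j : ℕ) / k, Nat.div_lt_of_lt_mul j.isLt⟩

end

end SuperParetoMarket

open SuperParetoMarket

namespace SuperParetoMarket

/-! ### Distortion risk measures as integrals over the line -/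

section Distortion

/-! Diversification hurts every agent, so each agent holds at most one loss, and the market reduces
to a problem in two scalars.

The probabilistic core is `measureReal_dot_le_lt`: for weights `θ` on the simplex other than a
vertex, `θ · X` has a distribution function strictly below that of `X₀` wherever the latter is
positive. If `θ · X ≤ t`, then each `X i` with `θ i > 0` lies below an explicit level. Weak negative
association bounds the joint probability by the product of the marginal ones, convexity of `f`
bounds each factor by `1 / (1 + θ i * y)` with `y = (1 - F) / F`, and `∏ (1 + θ i * y) > 1 + y = 1 /
F`.

Mild monotonicity is strict only under almost sure order, so `exists_identDistrib_lt` replaces `θ ·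
X` by a copy lying above `X₀` almost surely. With translation invariance and positive homogeneity of
distortion risk measures this yields `l1norm_mul_lt_risk`: a portfolio not concentrated at one index
has more than proportional risk.

Hence (`isMinOn_risk_iff`) an optimal portfolio is a multiple of a unit vector, placed on a loss of
maximal price, and its size solves a convex problem on `[0, ∞)`. By strict convexity all agents of
one type choose the same size: `s` for external and `t` for internal agents. Every loss has to be
held by someone, so all prices equal a common `q`, and summing the clearing condition gives `t = a -
k * s` (`isEquilibrium_iff`, `eq_sub_of_clearance`). The first-order conditions then determine `s`
and `q` in each regime (`firstOrder_iff_full`, `firstOrder_iff_partial`, `firstOrder_iff_none`).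
What remains is to count how many agents hold each loss. -/

/-- The integrand of the Choquet integral of a survival curve `H`. -/
noncomputable def choquetIntegrand (H : ℝ → ℝ) (x : ℝ) : ℝ := H x - (Iic (0 : ℝ)).indicator 1 x

lemma choquetIntegrand_integrable {H : ℝ → ℝ}
    (h₁ : IntegrableOn (fun x => H x - 1) (Iic 0)) (h₂ : IntegrableOn H (Ioi 0)) :
    Integrable (choquetIntegrand H) := by
  rw [← integrableOn_univ, ← Iic_union_Ioi (a := (0 : ℝ)), integrableOn_union]
  constructor
  · refine h₁.congr_fun (fun x hx => ?_) measurableSet_Iic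
    simp only [choquetIntegrand, indicator_of_mem hx, Pi.one_apply]
  · refine h₂.congr_fun (fun x hx => ?_) measurableSet_Ioi
    have : x ∉ Iic (0 : ℝ) := by simpa using hx
    simp only [choquetIntegrand, indicator_of_notMem this, sub_zero]

lemma integral_choquetIntegrand {H : ℝ → ℝ}
    (h₁ : IntegrableOn (fun x => H x - 1) (Iic 0)) (h₂ : IntegrableOn H (Ioi 0)) :
    ∫ x, choquetIntegrand H x = (∫ x in Iic (0 : ℝ), (H x - 1)) + ∫ x in Ioi (0 : ℝ), H x := by
  rw [← intervalIntegral.integral_Iic_add_Ioi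
    (choquetIntegrand_integrable h₁ h₂).integrableOn
    (choquetIntegrand_integrable h₁ h₂).integrableOn (b := 0)]
  congr 1
  · refine setIntegral_congr_fun measurableSet_Iic (fun x hx => ?_)
    simp only [choquetIntegrand, indicator_of_mem hx, Pi.one_apply]
  · refine setIntegral_congr_fun measurableSet_Ioi (fun x hx => ?_)
    have : x ∉ Iic (0 : ℝ) := by simpa using hx
    simp only [choquetIntegrand, indicator_of_notMem this, sub_zero]

lemma integral_indicator_Iic_sub (c : ℝ) :
    ∫ x : ℝ, ((Iic c).indicator (1 : ℝ → ℝ) x - (Iic (0 : ℝ)).indicator 1 x) = c := by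
  rcases le_total 0 c with hc | hc
  · have : (fun x : ℝ => (Iic c).indicator (1 : ℝ → ℝ) x - (Iic (0 : ℝ)).indicator 1 x)
        = (Ioc 0 c).indicator 1 := by
      funext x
      by_cases h1 : x ≤ 0
      · have h2 : x ≤ c := h1.trans hc
        simp [indicator, h1, h2]
      · by_cases h2 : x ≤ c <;> simp [indicator, h2, h1, not_le.1 h1]
    rw [this, integral_indicator_one measurableSet_Ioc]
    simp [hc]
  · have : (fun x : ℝ => (Iic c).indicator (1 : ℝ → ℝ) x - (Iic (0 : ℝ)).indicator 1 x)
        = fun x => -(Ioc c 0).indicator 1 x := by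
      funext x
      by_cases h1 : x ≤ c
      · have h2 : x ≤ 0 := h1.trans hc
        simp [indicator, h1, h2]
      · by_cases h2 : x ≤ 0 <;> simp [indicator, h2, h1, not_le.1 h1]
    rw [this, integral_neg, integral_indicator_one measurableSet_Ioc]
    simp [hc]

/-- A substitution shifts the curve and the indicator together; undoing the shift of the indicator
costs the signed length of the interval between `0` and `c`. -/
lemma integral_choquetIntegrand_sub {H : ℝ → ℝ} (hH : Integrable (choquetIntegrand H)) {c : ℝ}
    (hHc : Integrable (choquetIntegrand fun x => H (x - c))) :
    ∫ x, choquetIntegrand (fun x => H (x - c)) x = (∫ x, choquetIntegrand H x) + c := by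
  have hsh : Integrable fun x => choquetIntegrand H (x - c) := hH.comp_sub_right c
  have key : ∀ x, choquetIntegrand (fun x => H (x - c)) x - choquetIntegrand H (x - c)
      = (Iic c).indicator (1 : ℝ → ℝ) x - (Iic (0 : ℝ)).indicator 1 x := by
    intro x
    have : (Iic (0 : ℝ)).indicator (1 : ℝ → ℝ) (x - c) = (Iic c).indicator 1 x := by
      simp [indicator]
    simp only [choquetIntegrand, this]; ring
  have h := integral_sub hHc hsh
  rw [integral_congr_ae (ae_of_all _ key), integral_indicator_Iic_sub,
    integral_sub_right_eq_self (choquetIntegrand H) c] at h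
  linarith

/-- The half-line `Iic 0` is invariant under positive scaling, so this is a plain change of
variables. -/
lemma integral_choquetIntegrand_div (H : ℝ → ℝ) {l : ℝ} (hl : 0 < l) :
    ∫ x, choquetIntegrand (fun x => H (x / l)) x = l * ∫ x, choquetIntegrand H x := by
  have key : ∀ x, choquetIntegrand (fun x => H (x / l)) x = choquetIntegrand H (x / l) := by
    intro x
    have : (Iic (0 : ℝ)).indicator (1 : ℝ → ℝ) (x / l) = (Iic 0).indicator 1 x := by
      simp only [indicator, mem_Iic, div_le_iff₀ hl, zero_mul, Pi.one_apply]
    simp only [choquetIntegrand, this]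
  rw [integral_congr_ae (ae_of_all _ key), Measure.integral_comp_div, abs_of_pos hl, smul_eq_mul]

variable {Ω : Type*} [MeasurableSpace Ω] {μ : Measure Ω} {𝒳 : Set (Ω → ℝ)} {ρ : (Ω → ℝ) → ℝ}

lemma IsDistortionRiskMeasure.exists_eq_integral (h : IsDistortionRiskMeasure μ 𝒳 ρ) :
    ∃ g : ℝ → ℝ, g 0 = 0 ∧ g 1 = 1 ∧ ∀ Y ∈ 𝒳,
      Integrable (choquetIntegrand fun x => g (μ.real {ω | x < Y ω})) ∧
      ρ Y = ∫ x, choquetIntegrand (fun x => g (μ.real {ω | x < Y ω})) x := by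
  obtain ⟨g, -, -, h0, h1, hg⟩ := h
  refine ⟨g, h0, h1, fun Y hY => ?_⟩
  obtain ⟨i1, i2, e⟩ := hg Y hY
  exact ⟨choquetIntegrand_integrable i1 i2, by rw [e, integral_choquetIntegrand i1 i2]⟩

lemma IsDistortionRiskMeasure.add_const (h : IsDistortionRiskMeasure μ 𝒳 ρ) {Y : Ω → ℝ} {c : ℝ}
    (hY : Y ∈ 𝒳) (hYc : (fun ω => Y ω + c) ∈ 𝒳) : ρ (fun ω => Y ω + c) = ρ Y + c := by
  obtain ⟨g, -, -, hg⟩ := h.exists_eq_integral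
  obtain ⟨i, e⟩ := hg Y hY
  obtain ⟨ic, ec⟩ := hg _ hYc
  have : ∀ x, {ω | x < Y ω + c} = {ω | x - c < Y ω} := fun x => by
    ext ω; simp [sub_lt_iff_lt_add]
  simp only [this] at ic ec
  rw [ec, e]
  exact integral_choquetIntegrand_sub (H := fun x => g (μ.real {ω | x < Y ω})) i ic

lemma IsDistortionRiskMeasure.const_mul (h : IsDistortionRiskMeasure μ 𝒳 ρ) {Y : Ω → ℝ} {l : ℝ}
    (hl : 0 < l) (hY : Y ∈ 𝒳) (hYl : (fun ω => l * Y ω) ∈ 𝒳) :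
    ρ (fun ω => l * Y ω) = l * ρ Y := by
  obtain ⟨g, -, -, hg⟩ := h.exists_eq_integral
  obtain ⟨i, e⟩ := hg Y hY
  obtain ⟨il, el⟩ := hg _ hYl
  have : ∀ x, {ω | x < l * Y ω} = {ω | x / l < Y ω} := fun x => by
    ext ω; simp [div_lt_iff₀ hl, mul_comm]
  simp only [this] at el
  rw [el, e]
  exact integral_choquetIntegrand_div (fun x => g (μ.real {ω | x < Y ω})) hl

lemma IsDistortionRiskMeasure.zero [IsProbabilityMeasure μ] (h : IsDistortionRiskMeasure μ 𝒳 ρ)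
    (h0 : (fun _ => 0) ∈ 𝒳) : ρ (fun _ => 0) = 0 := by
  obtain ⟨g, g0, g1, hg⟩ := h.exists_eq_integral
  rw [(hg _ h0).2]
  refine integral_eq_zero_of_ae ?_
  -- At `x = 0` the integrand is `-1`, not `0`; the point is null.
  have : ∀ᵐ x : ℝ, x ≠ 0 := by simp [ae_iff]
  filter_upwards [this] with x hx
  rcases lt_or_gt_of_ne hx with hx | hx
  · simp [choquetIntegrand, hx, hx.le, g1]
  · simp [choquetIntegrand, not_lt.2 hx.le, g0, not_le.2 hx]

lemma MildlyMonotone.congr_identDistrib (h : MildlyMonotone μ 𝒳 ρ) {Y Z : Ω → ℝ} (hY : Y ∈ 𝒳)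
    (hZ : Z ∈ 𝒳) (hYZ : IdentDistrib Y Z μ μ) : ρ Y = ρ Z := by
  have : ∀ x : ℝ, μ {ω | x < Y ω} = μ {ω | x < Z ω} := fun x =>
    hYZ.measure_mem_eq measurableSet_Ioi
  exact le_antisymm (h.1 Y hY Z hZ fun x => (this x).le) (h.1 Z hZ Y hY fun x => (this x).ge)

end Distortion

/-! ### Super-Pareto distribution functions -/

lemma paretoMeasure_one_Iio_one : paretoMeasure 1 1 (Iio 1) = 0 := by
  rw [paretoMeasure, withDensity_apply _ measurableSet_Iio, lintegral_paretoPDF_of_le le_rfl]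

lemma paretoMeasure_one_singleton (x : ℝ) : paretoMeasure 1 1 {x} = 0 :=
  withDensity_absolutelyContinuous _ _ (by simp)

lemma paretoMeasure_one_real_Ioi {s : ℝ} (hs : 1 ≤ s) :
    (paretoMeasure 1 1).real (Ioi s) = 1 / s := by
  have hs0 : 0 < s := by linarith
  rw [measureReal_def, paretoMeasure, withDensity_apply _ measurableSet_Ioi]
  simp only [paretoPDF]
  rw [← integral_eq_lintegral_of_nonneg_ae]
  · have : ∫ x in Ioi s, paretoPDFReal 1 1 x = ∫ x in Ioi s, x ^ (-2 : ℝ) := by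
      refine setIntegral_congr_fun measurableSet_Ioi fun x hx => ?_
      have : (1 : ℝ) ≤ x := hs.trans (le_of_lt hx)
      simp only [paretoPDFReal, if_pos this]
      norm_num
    rw [this, integral_Ioi_rpow_of_lt (by norm_num) hs0]
    norm_num [Real.rpow_neg_one]
  · exact ae_of_all _ fun x => paretoPDFReal_nonneg zero_le_one zero_le_one x
  · exact (measurable_paretoPDFReal 1 1).aestronglyMeasurable

lemma paretoMeasure_one_real_Iic {s : ℝ} (hs : 1 ≤ s) :
    (paretoMeasure 1 1).real (Iic s) = 1 - 1 / s := by
  have := isProbabilityMeasure_paretoMeasure one_pos one_pos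
  rw [← paretoMeasure_one_real_Ioi hs, ← compl_Ioi, probReal_compl_eq_one_sub measurableSet_Ioi]

lemma paretoMeasure_one_ae : ∀ᵐ y ∂(paretoMeasure 1 1), 1 < y := by
  rw [ae_iff]
  have : {y : ℝ | ¬ 1 < y} = Iio 1 ∪ {1} := by
    ext y; simp [le_iff_lt_or_eq]
  rw [this]
  exact measure_union_null paretoMeasure_one_Iio_one (paretoMeasure_one_singleton 1)

/-- A convex, increasing, non-constant function on `[1, ∞)` is unbounded above. -/
lemma exists_lt_of_convexOn_of_monotoneOn {f : ℝ → ℝ} (hm : MonotoneOn f (Ici 1))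
    (hc : ConvexOn ℝ (Ici 1) f) (hne : ∃ x ∈ Ici (1 : ℝ), ∃ y ∈ Ici (1 : ℝ), f x ≠ f y) (t : ℝ) :
    ∃ y, 1 < y ∧ t < f y := by
  obtain ⟨x, y, hx, hxy, hf⟩ : ∃ x y : ℝ, 1 ≤ x ∧ x < y ∧ f x < f y := by
    obtain ⟨x, hx, y, hy, h⟩ := hne
    rcases lt_trichotomy x y with hxy | hxy | hxy
    · exact ⟨x, y, hx, hxy, lt_of_le_of_ne (hm hx hy hxy.le) h⟩
    · exact absurd (by rw [hxy]) h
    · exact ⟨y, x, hy, hxy, lt_of_le_of_ne (hm hy hx hxy.le) h.symm⟩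
  set d := (f y - f x) / (y - x) with hd
  have hd0 : 0 < d := div_pos (by linarith) (by linarith)
  obtain ⟨z, hzy, hz⟩ : ∃ z, y < z ∧ t < f y + d * (z - y) := by
    -- Chosen so that the secant line of slope `d` rises by `|t - f y| + d` beyond `y`.
    refine ⟨y + (|t - f y| / d + 1), ?_, ?_⟩
    · linarith [div_nonneg (abs_nonneg (t - f y)) hd0.le]
    · have : d * (y + (|t - f y| / d + 1) - y) = |t - f y| + d := by field_simp; ring
      rw [this]
      linarith [le_abs_self (t - f y)]
  refine ⟨z, by linarith, hz.trans_le ?_⟩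
  have h := hc.slope_mono_adjacent (show x ∈ Ici (1 : ℝ) from hx)
    (show z ∈ Ici (1 : ℝ) from (by simp only [mem_Ici]; linarith)) hxy hzy
  rw [← hd, le_div_iff₀ (by linarith)] at h
  linarith

variable {Ω : Type*} [MeasurableSpace Ω] {μ : Measure Ω} [IsProbabilityMeasure μ]

/-- Here `x₀ = f 1`. If `f y ≤ x₀ + (t - x₀) / θ`, convexity gives `f ((1 - θ) + θ * y) ≤ t`, so `(1
- θ) + θ * y` is at most the Pareto quantile `s` of level `F(t)`, that is `y ≤ 1 + (s - 1) / θ`. The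
Pareto distribution function at this point is `F / (F + θ * (1 - F))`; the bound is stated
multiplied out, which also covers `F = 0`. -/
lemma IsSuperPareto.exists_bound {Y : Ω → ℝ} (h : IsSuperPareto μ Y) (hY : Measurable Y) :
    ∃ x₀ : ℝ, (∀ᵐ ω ∂μ, x₀ ≤ Y ω) ∧ ∀ t, μ.real {ω | Y ω ≤ t} < 1 ∧
      ∀ θ ∈ Ioc (0 : ℝ) 1, μ.real {ω | Y ω ≤ x₀ + (t - x₀) / θ} *
          (μ.real {ω | Y ω ≤ t} + θ * (1 - μ.real {ω | Y ω ≤ t})) ≤ μ.real {ω | Y ω ≤ t} := by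
  obtain ⟨f, hm, hc, hne, hmap⟩ := h
  have hP := isProbabilityMeasure_paretoMeasure one_pos one_pos
  have hf : AEMeasurable f (paretoMeasure 1 1) := by
    -- Measurability of `f` is not assumed, but the pushforward under a map that is not a.e.
    -- measurable is `0`, whereas the law of `Y` has mass one.
    by_contra hf
    have := Measure.isProbabilityMeasure_map (μ := μ) hY.aemeasurable
    rw [Measure.map_of_not_aemeasurable hf] at hmap
    exact IsProbabilityMeasure.ne_zero _ hmap
  have hset : ∀ B : Set ℝ, MeasurableSet B → μ {ω | Y ω ∈ B} = paretoMeasure 1 1 (f ⁻¹' B) := by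
    intro B hB
    rw [← Measure.map_apply_of_aemeasurable hf hB, ← hmap, Measure.map_apply hY hB]; rfl
  have hF : ∀ t, μ.real {ω | Y ω ≤ t} = (paretoMeasure 1 1).real {y | f y ≤ t} := fun t => by
    rw [measureReal_def, measureReal_def]
    exact congrArg _ (hset (Iic t) measurableSet_Iic)
  have hlow : ∀ t y, 1 < y → f y ≤ t → 1 - 1 / y ≤ μ.real {ω | Y ω ≤ t} := by
    intro t y hy hyt
    rw [hF, ← paretoMeasure_one_real_Iic hy.le, measureReal_def, measureReal_def]
    refine ENNReal.toReal_mono (measure_ne_top _ _) (measure_mono_ae ?_)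
    filter_upwards [paretoMeasure_one_ae] with z hz hzy
    exact (hm (mem_Ici.2 hz.le) (mem_Ici.2 hy.le) hzy).trans hyt
  have hup : ∀ t s, 1 ≤ s → (∀ y, 1 < y → f y ≤ t → y ≤ s) →
      μ.real {ω | Y ω ≤ t} ≤ 1 - 1 / s := by
    intro t s hs hy
    rw [hF, ← paretoMeasure_one_real_Iic hs, measureReal_def, measureReal_def]
    refine ENNReal.toReal_mono (measure_ne_top _ _) (measure_mono_ae ?_)
    filter_upwards [paretoMeasure_one_ae] with z hz hzt
    exact hy z hz hzt
  have hlt : ∀ t, μ.real {ω | Y ω ≤ t} < 1 := by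
    intro t
    obtain ⟨y, hy, hty⟩ := exists_lt_of_convexOn_of_monotoneOn hm hc hne t
    refine (hup t y hy.le fun z hz hzt => ?_).trans_lt (by
      have : 0 < 1 / y := by positivity
      linarith)
    by_contra! hyz
    exact absurd (hm (mem_Ici.2 hy.le) (mem_Ici.2 hz.le) hyz.le) (by linarith)
  refine ⟨f 1, ?_, fun t => ⟨hlt t, fun θ hθ => ?_⟩⟩
  · have h0 : paretoMeasure 1 1 (f ⁻¹' Iio (f 1)) = 0 := by
      refine measure_mono_null (fun y hy => ?_) (ae_iff.1 paretoMeasure_one_ae)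
      intro h1
      exact absurd (hm (mem_Ici.2 le_rfl) (mem_Ici.2 h1.le) h1.le) (not_le.2 hy)
    rw [← hset _ measurableSet_Iio] at h0
    rw [ae_iff]
    simpa using h0
  · obtain ⟨hθ0, hθ1⟩ := hθ
    set F := μ.real {ω | Y ω ≤ t}
    have hF0 : 0 ≤ F := measureReal_nonneg
    have hF1 : F < 1 := hlt t
    set s := 1 / (1 - F) with hs
    have hF1' : 0 < 1 - F := by linarith
    have hs1 : s - 1 = F / (1 - F) := by rw [hs]; field_simp; ring
    have hq : 0 ≤ (s - 1) / θ := by rw [hs1]; positivity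
    have hsle : ∀ y, 1 < y → f y ≤ t → y ≤ s := by
      intro y hy hyt
      have h := hlow t y hy hyt
      have hy0 : 0 < y := by linarith
      rw [hs, le_div_iff₀ hF1']
      have : 1 - F ≤ 1 / y := by linarith
      calc y * (1 - F) ≤ y * (1 / y) := by gcongr
        _ = 1 := by field_simp
    have key := hup (f 1 + (t - f 1) / θ) (1 + (s - 1) / θ) (by linarith) (by
      intro y hy hyc
      have hconv := hc.2 (mem_Ici.2 le_rfl : (1 : ℝ) ∈ Ici (1 : ℝ)) (mem_Ici.2 hy.le)
        (sub_nonneg.2 hθ1) hθ0.le (by ring)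
      simp only [smul_eq_mul] at hconv
      have h1 : θ * f y ≤ θ * (f 1 + (t - f 1) / θ) := by gcongr
      have h2 : θ * (f 1 + (t - f 1) / θ) = θ * f 1 + (t - f 1) := by field_simp
      have := hsle ((1 - θ) * 1 + θ * y) (by nlinarith) (by linarith)
      rw [← sub_le_iff_le_add', le_div_iff₀ hθ0]
      linarith)
    have hpos : 0 < F + θ * (1 - F) := by positivity
    have heq : 1 - 1 / (1 + (s - 1) / θ) = F / (F + θ * (1 - F)) := by
      rw [hs1]
      have : 1 + F / (1 - F) / θ = (F + θ * (1 - F)) / (θ * (1 - F)) := by field_simp; ring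
      rw [this, one_div_div]; field_simp; ring
    rw [heq, le_div_iff₀ hpos] at key
    exact key

/-! ### Diversification increases the loss -/

section Dominance

variable {n : ℕ} {X : Fin n → Ω → ℝ}

/-- Lower orthants in the remaining coordinates are decreasing sets, so the conditional inequality,
multiplied out, splits off one coordinate at a time. -/
lemma WeaklyNegativelyAssociated.measureReal_le_prod (h : WeaklyNegativelyAssociated μ X)
    (hX : ∀ i, Measurable (X i)) (c : Fin n → ℝ) (T : Finset (Fin n)) :
    μ.real {ω | ∀ i ∈ T, X i ω ≤ c i} ≤ ∏ i ∈ T, μ.real {ω | X i ω ≤ c i} := by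
  induction T using Finset.induction_on with
  | empty => simp
  | insert i T hi ih =>
    rw [Finset.prod_insert hi]
    refine le_trans ?_ (mul_le_mul_of_nonneg_left ih measureReal_nonneg)
    have hset : {ω | ∀ j ∈ insert i T, X j ω ≤ c j}
        = {ω | X i ω ≤ c i} ∩ {ω | ∀ j ∈ T, X j ω ≤ c j} := by
      ext ω; simp
    rw [hset]
    have hmi : MeasurableSet {ω | X i ω ≤ c i} := measurableSet_le (hX i) measurable_const
    by_cases hpos : 0 < μ {ω | X i ω ≤ c i}
    · let S : Set ({j : Fin n // j ≠ i} → ℝ) := 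
        {x | ∀ j : {j : Fin n // j ≠ i}, (j : Fin n) ∈ T → x j ≤ c j}
      have hS : IsLowerSet S := fun x y hyx hx j hj => (hyx j).trans (hx j hj)
      have hSm : MeasurableSet S := by
        have : S = ⋂ j : {j : Fin n // j ≠ i}, ⋂ _ : (j : Fin n) ∈ T, {x | x j ≤ c j} := by
          ext x; simp [S]
        rw [this]
        exact MeasurableSet.iInter fun j => MeasurableSet.iInter fun _ =>
          measurableSet_le (measurable_pi_apply j) measurable_const
      have hpre : {ω | (fun j : {j : Fin n // j ≠ i} => X j ω) ∈ S}
          = {ω | ∀ j ∈ T, X j ω ≤ c j} := by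
        ext ω
        simp only [S, mem_ofPred_eq, Subtype.forall]
        exact ⟨fun h j hj => h j (fun e => hi (e ▸ hj)) hj, fun h j _ hj => h j hj⟩
      have h' := h i S (c i) hS hSm hpos
      rw [hpre, cond_apply hmi] at h'
      have h2 : μ ({ω | X i ω ≤ c i} ∩ {ω | ∀ j ∈ T, X j ω ≤ c j})
          ≤ μ {ω | X i ω ≤ c i} * μ {ω | ∀ j ∈ T, X j ω ≤ c j} := by
        have h3 := mul_le_mul_right h' (μ {ω | X i ω ≤ c i})
        rwa [← mul_assoc, ENNReal.mul_inv_cancel hpos.ne' (measure_ne_top _ _), one_mul] at h3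
      rw [measureReal_def, measureReal_def, measureReal_def, ← ENNReal.toReal_mul]
      exact ENNReal.toReal_mono (ENNReal.mul_ne_top (measure_ne_top _ _) (measure_ne_top _ _)) h2
    · have h0 : μ {ω | X i ω ≤ c i} = 0 := by simpa using hpos
      rw [measureReal_def, measure_mono_null inter_subset_left h0]
      simpa using mul_nonneg (measureReal_nonneg (μ := μ) (s := {ω | X i ω ≤ c i}))
        (measureReal_nonneg (μ := μ) (s := {ω | ∀ j ∈ T, X j ω ≤ c j}))

lemma one_add_sum_le_prod_one_add {ι : Type*} {f : ι → ℝ} (s : Finset ι) (hf : ∀ i, 0 ≤ f i) :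
    1 + ∑ i ∈ s, f i ≤ ∏ i ∈ s, (1 + f i) := by
  classical
  induction s using Finset.induction_on with
  | empty => simp
  | insert i s hi ih =>
    rw [Finset.sum_insert hi, Finset.prod_insert hi]
    have := mul_le_mul_of_nonneg_left ih (add_nonneg zero_le_one (hf i))
    nlinarith [mul_nonneg (hf i) (Finset.sum_nonneg fun j (_ : j ∈ s) => hf j)]

/-- For weights on the simplex that are not concentrated at one index, `∏ᵢ (1 + θᵢ y) > 1 + y`. -/
lemma one_add_lt_prod_one_add {θ : Fin n → ℝ} (hθ : θ ∈ stdSimplex ℝ (Fin n)) {j : Fin n}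
    (hj0 : 0 < θ j) (hj1 : θ j < 1) {y : ℝ} (hy : 0 < y) : 1 + y < ∏ i, (1 + θ i * y) := by
  have hsum : θ j + ∑ i ∈ Finset.univ.erase j, θ i = 1 := by
    rw [Finset.add_sum_erase _ _ (Finset.mem_univ j)]; exact hθ.2
  rw [← Finset.mul_prod_erase _ _ (Finset.mem_univ j)]
  have h1 : 1 + ∑ i ∈ Finset.univ.erase j, θ i * y
      ≤ ∏ i ∈ Finset.univ.erase j, (1 + θ i * y) :=
    one_add_sum_le_prod_one_add _ fun i => mul_nonneg (hθ.1 i) hy.le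
  rw [← Finset.sum_mul] at h1
  set σ := ∑ i ∈ Finset.univ.erase j, θ i
  have hσ : σ = 1 - θ j := by linarith
  -- Splitting the total weight into `θ j` and `1 - θ j` already creates the positive cross term
  -- that makes the inequality strict.
  calc 1 + y < (1 + θ j * y) * (1 + σ * y) := by
        rw [hσ]
        have : 0 < θ j * y * ((1 - θ j) * y) := by
          have := sub_pos.2 hj1
          positivity
        nlinarith
    _ ≤ _ := mul_le_mul_of_nonneg_left h1 (by positivity)

lemma measureReal_dot_le_lt {X₀ : Ω → ℝ} (hX : ∀ i, Measurable (X i)) (hX₀ : Measurable X₀)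
    (hid : ∀ i, IdentDistrib (X i) X₀ μ μ) (hwna : WeaklyNegativelyAssociated μ X)
    (hsp : IsSuperPareto μ X₀) {θ : Fin n → ℝ} (hθ : θ ∈ stdSimplex ℝ (Fin n)) {j : Fin n}
    (hj0 : 0 < θ j) (hj1 : θ j < 1) {t : ℝ} (ht : 0 < μ.real {ω | X₀ ω ≤ t}) :
    μ.real {ω | dot θ (fun i => X i ω) ≤ t} < μ.real {ω | X₀ ω ≤ t} := by
  obtain ⟨x₀, hx₀, hb⟩ := hsp.exists_bound hX₀
  obtain ⟨hF1, hF⟩ := hb t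
  have hFX : ∀ i c, μ.real {ω | X i ω ≤ c} = μ.real {ω | X₀ ω ≤ c} := fun i c =>
    congrArg ENNReal.toReal ((hid i).measure_mem_eq measurableSet_Iic)
  have hae : ∀ᵐ ω ∂μ, ∀ i, x₀ ≤ X i ω := by
    rw [ae_all_iff]
    exact fun i => (hid i).symm.ae_snd (p := fun x => x₀ ≤ x) measurableSet_Ici hx₀
  set F := μ.real {ω | X₀ ω ≤ t}
  have hG : 0 < 1 - F := by linarith
  -- Coordinates of weight zero are left unconstrained; in the product below they correspond to
  -- factors equal to `1`.
  let T : Finset (Fin n) := Finset.univ.filter fun i => 0 < θ i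
  let c : Fin n → ℝ := fun i => x₀ + (t - x₀) / θ i
  have hθ1 : ∀ i, θ i ≤ 1 := fun i => by
    rw [← hθ.2]; exact Finset.single_le_sum (fun k _ => hθ.1 k) (Finset.mem_univ i)
  have hincl : μ.real {ω | dot θ (fun i => X i ω) ≤ t} ≤ μ.real {ω | ∀ i ∈ T, X i ω ≤ c i} := by
    rw [measureReal_def, measureReal_def]
    refine ENNReal.toReal_mono (measure_ne_top _ _) (measure_mono_ae ?_)
    filter_upwards [hae] with ω hω hdot i hi
    have hi0 : 0 < θ i := (Finset.mem_filter.1 hi).2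
    have hsub : ∑ k, θ k * (X k ω - x₀) ≤ t - x₀ := by
      have : ∑ k, θ k * (X k ω - x₀) = dot θ (fun i => X i ω) - x₀ := by
        simp only [mul_sub, Finset.sum_sub_distrib, ← Finset.sum_mul, hθ.2, one_mul, dot]
      rw [this]
      exact sub_le_sub_right hdot _
    have hsing := Finset.single_le_sum (f := fun k => θ k * (X k ω - x₀))
      (fun k _ => mul_nonneg (hθ.1 k) (sub_nonneg.2 (hω k))) (Finset.mem_univ i)
    show X i ω ≤ x₀ + (t - x₀) / θ i
    rw [← sub_le_iff_le_add', le_div_iff₀ hi0]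
    have : θ i * (X i ω - x₀) ≤ t - x₀ := hsing.trans hsub
    linarith
  have hprod : μ.real {ω | ∀ i ∈ T, X i ω ≤ c i} ≤ ∏ i ∈ T, F / (F + θ i * (1 - F)) := by
    refine (hwna.measureReal_le_prod hX c T).trans
      (Finset.prod_le_prod (fun _ _ => measureReal_nonneg) fun i hi => ?_)
    have hi0 : 0 < θ i := (Finset.mem_filter.1 hi).2
    rw [hFX, le_div_iff₀ (by positivity)]
    exact hF (θ i) ⟨hi0, hθ1 i⟩
  have hnorm : ∏ i ∈ T, F / (F + θ i * (1 - F)) = ∏ i, (1 + θ i * ((1 - F) / F))⁻¹ := by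
    rw [Finset.prod_filter]
    refine Finset.prod_congr rfl fun i _ => ?_
    split_ifs with hi
    · have : 1 + θ i * ((1 - F) / F) = (F + θ i * (1 - F)) / F := by field_simp
      rw [this, inv_div]
    · have : θ i = 0 := le_antisymm (not_lt.1 hi) (hθ.1 i)
      simp [this]
  have hprodlt : ∏ i, (1 + θ i * ((1 - F) / F))⁻¹ < F := by
    rw [Finset.prod_inv_distrib]
    have h := one_add_lt_prod_one_add hθ hj0 hj1 (div_pos hG ht)
    have hF' : 1 + (1 - F) / F = F⁻¹ := by field_simp; ring
    rw [hF'] at h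
    exact inv_lt_of_inv_lt₀ ht h
  linarith

end Dominance

/-! ### A coupling of strictly ordered distributions -/

section Coupling

open Filter Topology

variable {Ω : Type*} [MeasurableSpace Ω] {μ : Measure Ω} [IsProbabilityMeasure μ]

/-- The quantile function of a distribution function `G`, set to zero outside `(0, 1)`. -/
noncomputable def quantile (G : ℝ → ℝ) (v : ℝ) : ℝ :=
  if v ∈ Ioo (0 : ℝ) 1 then sInf {t | v ≤ G t} else 0

/-- The Galois connection between a distribution function and its quantile function; right
continuity passes the inequality from points above `t` to `t` itself. -/
lemma quantile_le_iff (ν : Measure ℝ) [IsProbabilityMeasure ν] {v : ℝ} (hv : v ∈ Ioo (0 : ℝ) 1)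
    (t : ℝ) : quantile (cdf ν) v ≤ t ↔ v ≤ cdf ν t := by
  rw [quantile, if_pos hv]
  have hbdd : BddBelow {t | v ≤ cdf ν t} := by
    obtain ⟨b, hb⟩ := ((tendsto_cdf_atBot ν).eventually_lt_const hv.1).exists
    refine ⟨b, fun t ht => ?_⟩
    by_contra! h
    exact absurd (monotone_cdf ν h.le) (by simp only [mem_ofPred_eq] at ht; linarith)
  have hne : {t | v ≤ cdf ν t}.Nonempty := by
    obtain ⟨b, hb⟩ := ((tendsto_cdf_atTop ν).eventually_const_lt hv.2).exists
    exact ⟨b, hb.le⟩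
  refine ⟨fun h => ?_, fun h => csInf_le hbdd h⟩
  have hlim : Tendsto (cdf ν) (𝓝[>] t) (𝓝 (cdf ν t)) :=
    ((cdf ν).right_continuous t).mono_left (nhdsWithin_mono _ Ioi_subset_Ici_self)
  refine ge_of_tendsto hlim ?_
  filter_upwards [self_mem_nhdsWithin] with s hs
  obtain ⟨r, hr, hrs⟩ := exists_lt_of_csInf_lt hne (h.trans_lt hs)
  exact le_trans hr (monotone_cdf ν hrs.le)

lemma measurable_quantile (ν : Measure ℝ) [IsProbabilityMeasure ν] :
    Measurable (quantile (cdf ν)) := by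
  refine measurable_of_Iic fun t => ?_
  have : quantile (cdf ν) ⁻¹' Iic t
      = (Ioo 0 1 ∩ Iic (cdf ν t)) ∪ ((Ioo 0 1)ᶜ ∩ {_v : ℝ | (0 : ℝ) ≤ t}) := by
    ext v
    by_cases hv : v ∈ Ioo (0 : ℝ) 1
    · have := quantile_le_iff ν hv t
      simp only [mem_preimage, mem_Iic, this, mem_union, mem_inter_iff, hv, true_and,
        mem_compl_iff, not_true_eq_false, false_and, or_false]
    · simp only [mem_preimage, mem_Iic, quantile, if_false, mem_union, mem_inter_iff, hv,
        false_and, mem_compl_iff, not_false_eq_true, true_and, false_or, mem_ofPred_eq]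
  rw [this]
  exact (measurableSet_Ioo.inter measurableSet_Iic).union
    (measurableSet_Ioo.compl.inter (MeasurableSet.const _))

/-- The probability integral transform of an atomless law is uniform on `[0, 1]`. -/
lemma measureReal_cdf_le (ν : Measure ℝ) [IsProbabilityMeasure ν] [NullSingletonClass ν] {v : ℝ}
    (hv0 : 0 ≤ v) (hv1 : v < 1) : ν.real {x | cdf ν x ≤ v} = v := by
  -- The jump of the distribution function at `x` is the mass of `{x}`.
  have hcont : Continuous (cdf ν) := by
    refine continuous_iff_continuousAt.2 fun x => ?_
    rw [(monotone_cdf ν).continuousAt_iff_leftLim_eq_rightLim]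
    have h := StieltjesFunction.measure_singleton (cdf ν) x
    rw [measure_cdf, measure_singleton, eq_comm, ENNReal.ofReal_eq_zero, sub_nonpos] at h
    rw [(cdf ν).rightLim_eq]
    exact le_antisymm ((monotone_cdf ν).leftLim_le le_rfl) h
  obtain ⟨b, hb⟩ := ((tendsto_cdf_atTop ν).eventually_const_lt hv1).exists
  have hup : ∀ x, cdf ν x ≤ v → x ≤ b := fun x hx => by
    by_contra! h
    exact absurd (monotone_cdf ν h.le) (by linarith)
  rcases Set.eq_empty_or_nonempty {x | cdf ν x ≤ v} with he | hne
  · rcases hv0.eq_or_lt with rfl | hv0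
    · rw [he]; simp
    · obtain ⟨x, hx⟩ := ((tendsto_cdf_atBot ν).eventually_lt_const hv0).exists
      exact absurd (show x ∈ {x | cdf ν x ≤ v} from hx.le) (by rw [he]; exact notMem_empty x)
  · have hclosed : IsClosed {x | cdf ν x ≤ v} := isClosed_le hcont continuous_const
    -- By continuity the sublevel set is `Iic s`, and the value at `s` is exactly `v`.
    set s := sSup {x | cdf ν x ≤ v} with hs
    have hsmem : cdf ν s ≤ v := hclosed.csSup_mem hne ⟨b, hup⟩
    have hset : {x | cdf ν x ≤ v} = Iic s := by
      ext x
      exact ⟨fun hx => le_csSup ⟨b, hup⟩ hx, fun hx => (monotone_cdf ν hx).trans hsmem⟩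
    have hge : v ≤ cdf ν s := by
      have hlim : Tendsto (cdf ν) (𝓝[>] s) (𝓝 (cdf ν s)) :=
        hcont.continuousAt.mono_left nhdsWithin_le_nhds
      refine ge_of_tendsto hlim ?_
      filter_upwards [self_mem_nhdsWithin] with r hr
      by_contra! h
      have : r ∈ Iic s := hset ▸ h.le
      exact absurd (mem_Iic.1 this) (not_le.2 hr)
    rw [hset, ← cdf_eq_real]
    exact le_antisymm hsmem hge

/-- If `Z` has a strictly smaller distribution function than `Y` wherever that of `Y` is
positive, and `Y` is atomless, then some copy of `Z` exceeds `Y` almost surely. -/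
lemma exists_identDistrib_lt {Y Z : Ω → ℝ} (hY : Measurable Y) (hZ : Measurable Z)
    (hcont : ∀ x : ℝ, μ {ω | Y ω = x} = 0)
    (hlt : ∀ t, 0 < μ.real {ω | Y ω ≤ t} → μ.real {ω | Z ω ≤ t} < μ.real {ω | Y ω ≤ t}) :
    ∃ Z' : Ω → ℝ, Measurable Z' ∧ IdentDistrib Z' Z μ μ ∧ ∀ᵐ ω ∂μ, Y ω < Z' ω := by
  set νY := μ.map Y with hνY
  set νZ := μ.map Z with hνZ
  have : IsProbabilityMeasure νY := Measure.isProbabilityMeasure_map hY.aemeasurable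
  have : IsProbabilityMeasure νZ := Measure.isProbabilityMeasure_map hZ.aemeasurable
  have : NullSingletonClass νY := ⟨fun x => by
    rw [hνY, Measure.map_apply hY (measurableSet_singleton x)]; exact hcont x⟩
  have hFY : ∀ t, cdf νY t = μ.real {ω | Y ω ≤ t} := fun t => by
    rw [cdf_eq_real, measureReal_def, hνY, Measure.map_apply hY measurableSet_Iic]; rfl
  have hFZ : ∀ t, cdf νZ t = μ.real {ω | Z ω ≤ t} := fun t => by
    rw [cdf_eq_real, measureReal_def, hνZ, Measure.map_apply hZ measurableSet_Iic]; rfl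
  have hFm : Measurable (cdf νY) := (monotone_cdf νY).measurable
  have hunif : ∀ v, 0 ≤ v → v < 1 → μ.real {ω | cdf νY (Y ω) ≤ v} = v := by
    intro v h0 h1
    refine Eq.trans ?_ (measureReal_cdf_le νY h0 h1)
    rw [measureReal_def, measureReal_def]
    conv_rhs => rw [hνY, Measure.map_apply hY (measurableSet_le hFm measurable_const)]
    rfl
  have hpos : ∀ᵐ ω ∂μ, 0 < cdf νY (Y ω) := by
    rw [ae_iff]
    have h := hunif 0 le_rfl one_pos
    rw [measureReal_def, ENNReal.toReal_eq_zero_iff] at h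
    simpa using h.resolve_right (measure_ne_top _ _)
  have hlt1 : ∀ᵐ ω ∂μ, cdf νY (Y ω) < 1 := by
    rw [ae_iff]
    -- Uniformity is available for levels below `1` only, so the top value is excluded by letting
    -- `v` tend to `1`.
    have hle : ∀ v, 0 ≤ v → v < 1 → μ.real {ω | ¬ cdf νY (Y ω) < 1} ≤ 1 - v := by
      intro v h0 h1
      have hm : MeasurableSet {ω | cdf νY (Y ω) ≤ v} :=
        measurableSet_le (hFm.comp hY) measurable_const
      rw [← hunif v h0 h1, ← probReal_compl_eq_one_sub hm]
      refine measureReal_mono (fun ω hω => ?_)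
      simp only [mem_ofPred_eq, not_lt, mem_compl_iff, not_le] at hω ⊢
      linarith
    have h0 : μ.real {ω | ¬ cdf νY (Y ω) < 1} ≤ 0 := by
      refine le_of_forall_pos_le_add fun ε hε => ?_
      have := hle (max 0 (1 - ε)) (le_max_left _ _) (max_lt one_pos (by linarith))
      linarith [le_max_right 0 (1 - ε)]
    have := le_antisymm h0 measureReal_nonneg
    rw [measureReal_def, ENNReal.toReal_eq_zero_iff] at this
    exact this.resolve_right (measure_ne_top _ _)
  -- The monotone coupling: `cdf νY (Y ω)` is uniform, and the quantile function of `Z` turns it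
  -- into a copy of `Z`. By the Galois connection, `Y < Z'` means that the distribution function of
  -- `Z` at `Y ω` is below that of `Y`.
  have hZ'm : Measurable fun ω => quantile (cdf νZ) (cdf νY (Y ω)) :=
    (measurable_quantile νZ).comp (hFm.comp hY)
  refine ⟨fun ω => quantile (cdf νZ) (cdf νY (Y ω)), hZ'm,
    ⟨hZ'm.aemeasurable, hZ.aemeasurable, ?_⟩, ?_⟩
  · have := Measure.isProbabilityMeasure_map (μ := μ) hZ'm.aemeasurable
    refine Measure.eq_of_cdf _ _ (StieltjesFunction.ext fun t => ?_)
    rw [cdf_eq_real, measureReal_def, Measure.map_apply hZ'm measurableSet_Iic]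
    have : μ ((fun ω => quantile (cdf νZ) (cdf νY (Y ω))) ⁻¹' Iic t)
        = μ {ω | cdf νY (Y ω) ≤ cdf νZ t} := by
      refine measure_congr ?_
      filter_upwards [hpos, hlt1] with ω h0 h1
      exact propext (quantile_le_iff νZ ⟨h0, h1⟩ t)
    rw [this, ← measureReal_def]
    rcases (cdf_le_one νZ t).eq_or_lt with h | h
    · rw [h]
      have : {ω | cdf νY (Y ω) ≤ 1} = univ := eq_univ_of_forall fun ω => cdf_le_one _ _
      rw [this]; simp
    · exact hunif _ (cdf_nonneg _ _) h
  · filter_upwards [hpos, hlt1] with ω h0 h1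
    rw [← not_le, quantile_le_iff νZ ⟨h0, h1⟩, not_le, hFY, hFZ]
    exact hlt _ (by rwa [← hFY])

end Coupling

/-! ### The risk of a portfolio -/

section Portfolio

variable {n : ℕ}

lemma unitExposure_nonneg {b : ℝ} (hb : 0 ≤ b) (i : Fin n) : 0 ≤ unitExposure b i :=
  Pi.single_nonneg.2 hb

lemma dot_unitExposure (b : ℝ) (i : Fin n) (x : Fin n → ℝ) : dot (unitExposure b i) x = b * x i := by
  simp [dot, unitExposure, Pi.single_apply]

lemma dot_sub (v w x : Fin n → ℝ) : dot (v - w) x = dot v x - dot w x := by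
  simp [dot, sub_mul, Finset.sum_sub_distrib]

lemma l1norm_nonneg (v : Fin n → ℝ) : 0 ≤ l1norm v := Finset.sum_nonneg fun _ _ => abs_nonneg _

lemma l1norm_of_nonneg {v : Fin n → ℝ} (hv : 0 ≤ v) : l1norm v = ∑ j, v j :=
  Finset.sum_congr rfl fun j _ => abs_of_nonneg (hv j)

lemma l1norm_unitExposure {b : ℝ} (hb : 0 ≤ b) (i : Fin n) : l1norm (unitExposure b i) = b := by
  rw [l1norm_of_nonneg (unitExposure_nonneg hb i)]
  simp [unitExposure, Pi.single_apply]

lemma dot_le_l1norm_mul {v p : Fin n → ℝ} (hv : 0 ≤ v) {P : ℝ} (hP : ∀ i, p i ≤ P) :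
    dot v p ≤ l1norm v * P := by
  rw [l1norm_of_nonneg hv, Finset.sum_mul]
  exact Finset.sum_le_sum fun i _ => mul_le_mul_of_nonneg_left (hP i) (hv i)

/-- A non-negative vector that is not concentrated at one index has a coordinate that is
positive and smaller than its norm. -/
lemma exists_pos_lt_l1norm [NeZero n] {v : Fin n → ℝ} (hv : 0 ≤ v)
    (h : ∀ i, v ≠ unitExposure (l1norm v) i) : ∃ j, 0 < v j ∧ v j < l1norm v := by
  have hex : ∃ j, 0 < v j := by
    by_contra! h0
    have hv0 : v = 0 := le_antisymm h0 hv
    -- The zero vector counts as concentrated, being an exposure of size `0`.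
    refine h 0 ?_
    subst hv0
    simp [l1norm, unitExposure]
  obtain ⟨j, hj⟩ := hex
  refine ⟨j, hj, ?_⟩
  rw [l1norm_of_nonneg hv]
  have hle : v j ≤ ∑ i, v i := Finset.single_le_sum (fun i _ => hv i) (Finset.mem_univ j)
  refine lt_of_le_of_ne hle fun heq => h j ?_
  rw [l1norm_of_nonneg hv, ← heq]
  have hsum : ∑ i ∈ Finset.univ.erase j, v i = 0 := by
    have := Finset.add_sum_erase _ v (Finset.mem_univ j)
    linarith
  rw [Finset.sum_eq_zero_iff_of_nonneg fun i _ => hv i] at hsum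
  funext i
  by_cases hi : i = j
  · subst hi; simp [unitExposure]
  · rw [hsum i (by simp [hi])]; simp [unitExposure, hi]

variable {Ω : Type*} {X : Fin n → Ω → ℝ} {X₀ : Ω → ℝ} {𝒳 : Set (Ω → ℝ)} {ρ : (Ω → ℝ) → ℝ}

lemma dot_mem_of_cone
    (hcone : ∀ v : Fin n → ℝ, 0 ≤ v → ∀ c : ℝ, (fun ω => dot v (fun j => X j ω) + c) ∈ 𝒳)
    {v : Fin n → ℝ} (hv : 0 ≤ v) : (fun ω => dot v (fun j => X j ω)) ∈ 𝒳 := by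
  simpa using hcone v hv 0

variable [MeasurableSpace Ω] {μ : Measure Ω}

lemma risk_dot_sub
    (hcone : ∀ v : Fin n → ℝ, 0 ≤ v → ∀ c : ℝ, (fun ω => dot v (fun j => X j ω) + c) ∈ 𝒳)
    (hρ : IsDistortionRiskMeasure μ 𝒳 ρ) {v : Fin n → ℝ} (hv : 0 ≤ v) (c : ℝ) :
    ρ (fun ω => dot v (fun j => X j ω) - c) = ρ (fun ω => dot v (fun j => X j ω)) - c := by
  simpa only [← sub_eq_add_neg] using
    hρ.add_const (dot_mem_of_cone hcone hv) (hcone v hv (-c))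

lemma risk_dot_smul
    (hcone : ∀ v : Fin n → ℝ, 0 ≤ v → ∀ c : ℝ, (fun ω => dot v (fun j => X j ω) + c) ∈ 𝒳)
    (hρ : IsDistortionRiskMeasure μ 𝒳 ρ) {v : Fin n → ℝ} (hv : 0 ≤ v) {b : ℝ} (hb : 0 < b) :
    ρ (fun ω => dot (b • v) (fun j => X j ω)) = b * ρ (fun ω => dot v (fun j => X j ω)) := by
  have h : ∀ ω, dot (b • v) (fun j => X j ω) = b * dot v (fun j => X j ω) := fun ω => by
    simp [dot, Finset.mul_sum, mul_assoc]
  have hmem := dot_mem_of_cone hcone (smul_nonneg hb.le hv)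
  simp only [h] at hmem ⊢
  exact hρ.const_mul hb (dot_mem_of_cone hcone hv) hmem

variable [IsProbabilityMeasure μ]

lemma risk_unitExposure
    (hX₀ : Measurable X₀) (hid : ∀ i, IdentDistrib (X i) X₀ μ μ)
    (hcone : ∀ v : Fin n → ℝ, 0 ≤ v → ∀ c : ℝ, (fun ω => dot v (fun j => X j ω) + c) ∈ 𝒳)
    (hlaw : ∀ θ ∈ stdSimplex ℝ (Fin n), ∀ Y : Ω → ℝ, Measurable Y →
      IdentDistrib Y (fun ω => dot θ (fun j => X j ω)) μ μ → Y ∈ 𝒳)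
    (hρ : IsDistortionRiskMeasure μ 𝒳 ρ) (hρ' : MildlyMonotone μ 𝒳 ρ)
    {b : ℝ} (hb : 0 ≤ b) (i : Fin n) :
    X₀ ∈ 𝒳 ∧ ρ (fun ω => dot (unitExposure b i) (fun j => X j ω)) = b * ρ X₀ := by
  have h1 : (fun ω => dot (unitExposure 1 i) (fun j => X j ω)) = X i := by
    funext ω; rw [dot_unitExposure, one_mul]
  have hX₀mem : X₀ ∈ 𝒳 := by
    refine hlaw (unitExposure 1 i) (single_mem_stdSimplex ℝ i) X₀ hX₀ ?_
    rw [h1]; exact (hid i).symm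
  refine ⟨hX₀mem, ?_⟩
  rcases hb.eq_or_lt with rfl | hb
  · have h0 : (fun ω => dot (unitExposure 0 i) (fun j => X j ω)) = fun _ => 0 := by
      funext ω; rw [dot_unitExposure, zero_mul]
    have := dot_mem_of_cone hcone (unitExposure_nonneg le_rfl i)
    rw [h0] at this ⊢
    rw [hρ.zero this, zero_mul]
  · have hs : unitExposure b i = b • unitExposure 1 i := by
      simp [unitExposure, ← Pi.single_smul]
    have hmem := dot_mem_of_cone hcone (unitExposure_nonneg zero_le_one i)
    rw [hs, risk_dot_smul hcone hρ (unitExposure_nonneg zero_le_one i) hb]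
    rw [h1] at hmem ⊢
    rw [hρ'.congr_identDistrib hmem hX₀mem (hid i)]

/-- Diversification strictly increases the risk per unit of exposure. -/
lemma l1norm_mul_lt_risk [NeZero n]
    (hX : ∀ i, Measurable (X i)) (hX₀ : Measurable X₀) (hid : ∀ i, IdentDistrib (X i) X₀ μ μ)
    (hwna : WeaklyNegativelyAssociated μ X) (hsp : IsSuperPareto μ X₀)
    (hcont : ∀ x : ℝ, μ {ω | X₀ ω = x} = 0)
    (hcone : ∀ v : Fin n → ℝ, 0 ≤ v → ∀ c : ℝ, (fun ω => dot v (fun j => X j ω) + c) ∈ 𝒳)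
    (hlaw : ∀ θ ∈ stdSimplex ℝ (Fin n), ∀ Y : Ω → ℝ, Measurable Y →
      IdentDistrib Y (fun ω => dot θ (fun j => X j ω)) μ μ → Y ∈ 𝒳)
    (hρ : IsDistortionRiskMeasure μ 𝒳 ρ) (hρ' : MildlyMonotone μ 𝒳 ρ)
    {v : Fin n → ℝ} (hv : 0 ≤ v) (h : ∀ i, v ≠ unitExposure (l1norm v) i) :
    l1norm v * ρ X₀ < ρ (fun ω => dot v (fun j => X j ω)) := by
  obtain ⟨j, hj0, hj1⟩ := exists_pos_lt_l1norm hv h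
  set b := l1norm v with hb
  have hb0 : 0 < b := hj0.trans hj1
  set θ : Fin n → ℝ := b⁻¹ • v with hθdef
  have hθ0 : 0 ≤ θ := smul_nonneg (inv_nonneg.2 hb0.le) hv
  have hvθ : v = b • θ := by rw [hθdef, smul_inv_smul₀ hb0.ne']
  have hθ : θ ∈ stdSimplex ℝ (Fin n) := by
    refine ⟨hθ0, ?_⟩
    simp only [hθdef, Pi.smul_apply, smul_eq_mul, ← Finset.mul_sum]
    rw [← l1norm_of_nonneg hv, ← hb, inv_mul_cancel₀ hb0.ne']
  have hθj0 : 0 < θ j := mul_pos (inv_pos.2 hb0) hj0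
  have hθj1 : θ j < 1 := by
    simp only [hθdef, Pi.smul_apply, smul_eq_mul]
    rwa [inv_mul_lt_one₀ hb0]
  have hZ : Measurable fun ω => dot θ (fun j => X j ω) := by
    unfold dot
    exact Finset.measurable_sum _ fun i _ => (hX i).const_mul _
  -- Stochastic dominance alone would give only a weak inequality of risks; the coupled copy, which
  -- lies in `𝒳` by its law, makes it strict.
  obtain ⟨Z', hZ'm, hZ'id, hZ'lt⟩ := exists_identDistrib_lt hX₀ hZ hcont fun t ht =>
    measureReal_dot_le_lt hX hX₀ hid hwna hsp hθ hθj0 hθj1 ht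
  have hZ'mem : Z' ∈ 𝒳 := hlaw θ hθ Z' hZ'm hZ'id
  have hX₀mem : X₀ ∈ 𝒳 := (risk_unitExposure hX₀ hid hcone hlaw hρ hρ' zero_le_one j).1
  have hlt : ρ X₀ < ρ (fun ω => dot θ (fun j => X j ω)) := by
    rw [← hρ'.congr_identDistrib hZ'mem (dot_mem_of_cone hcone hθ0) hZ'id]
    exact hρ'.2 _ hX₀mem _ hZ'mem hZ'lt
  rw [hvθ, risk_dot_smul hcone hρ hθ0 hb0]
  exact mul_lt_mul_of_pos_left hlt hb0

/-- An agent whose risk is at least proportional to the exposure, with equality only for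
exposures concentrated at one index, buys one of the best paid losses only. -/
lemma isMinOn_risk_iff {R : (Fin n → ℝ) → ℝ} {r : ℝ}
    (hR : ∀ b : ℝ, 0 ≤ b → ∀ i, R (unitExposure b i) = b * r)
    (hR' : ∀ v : Fin n → ℝ, 0 ≤ v → (∀ i, v ≠ unitExposure (l1norm v) i) → l1norm v * r < R v)
    (C : ℝ → ℝ) {p : Fin n → ℝ} {P : ℝ} (hP : ∀ i, p i ≤ P) (hP' : ∃ i, p i = P)
    {v₀ : Fin n → ℝ} :
    (0 ≤ v₀ ∧ IsMinOn (fun v => R v - dot v p + C (l1norm v)) {v | 0 ≤ v} v₀) ↔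
      ∃ b, 0 ≤ b ∧ ∃ i, v₀ = unitExposure b i ∧ (0 < b → p i = P) ∧
        IsMinOn (fun b => b * (r - P) + C b) (Ici 0) b := by
  have hRle : ∀ v : Fin n → ℝ, 0 ≤ v → l1norm v * r ≤ R v := fun v hv => by
    by_cases h : ∀ i, v ≠ unitExposure (l1norm v) i
    · exact (hR' v hv h).le
    · push Not at h
      obtain ⟨i, hi⟩ := h
      conv_rhs => rw [hi]
      exact (hR _ (l1norm_nonneg v) i).ge
  constructor
  · rintro ⟨hv, hmin⟩
    rw [isMinOn_iff] at hmin
    obtain ⟨i₀, hi₀⟩ := hP'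
    -- The competitor puts the whole size `b` on a best paid loss.
    have hcomp : ∀ b, 0 ≤ b → R v₀ - dot v₀ p + C (l1norm v₀) ≤ b * (r - P) + C b := by
      intro b hb
      have h := hmin (unitExposure b i₀) (unitExposure_nonneg hb i₀)
      simp only [hR b hb, dot_unitExposure, hi₀, l1norm_unitExposure hb] at h
      linarith
    -- At `b = l1norm v₀` the comparison squeezes both the risk bound and the price bound into
    -- equalities.
    have hb := l1norm_nonneg v₀
    have h1 := hcomp _ hb
    have h2 := hRle v₀ hv
    have h3 := dot_le_l1norm_mul hv hP
    have hRv : R v₀ = l1norm v₀ * r := by linarith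
    have hdot : dot v₀ p = l1norm v₀ * P := by linarith
    obtain ⟨i, hi⟩ : ∃ i, v₀ = unitExposure (l1norm v₀) i := by
      by_contra! h
      exact absurd (hR' v₀ hv h) (by linarith)
    refine ⟨l1norm v₀, hb, i, hi, fun hpos => ?_, ?_⟩
    · rw [hi, dot_unitExposure, ← hi] at hdot
      exact mul_left_cancel₀ hpos.ne' hdot
    · rw [isMinOn_iff]
      intro b' hb'
      have := hcomp b' hb'
      linarith
  · rintro ⟨b, hb, i, rfl, hi, hmin⟩
    refine ⟨unitExposure_nonneg hb i, ?_⟩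
    rw [isMinOn_iff] at hmin ⊢
    intro v hv
    have h1 := hmin (l1norm v) (l1norm_nonneg v)
    have h2 := hRle v hv
    have h3 := dot_le_l1norm_mul hv hP
    have h4 : b * p i = b * P := by
      rcases hb.eq_or_lt with rfl | hb
      · simp
      · rw [hi hb]
    simp only [hR b hb, dot_unitExposure, l1norm_unitExposure hb]
    linarith

end Portfolio

/-! ### One-sided derivatives of cost functions -/

section Cost

variable {c : ℝ → ℝ}

/-- The slope of the chord lies strictly between the two. This is the only form in which strict
convexity enters the first-order conditions. -/
lemma rightDeriv_lt_leftDeriv (hc : StrictConvexOn ℝ univ c) {x y : ℝ} (hxy : x < y) :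
    derivWithin c (Ioi x) x < derivWithin c (Iio y) y := by
  have hx : x ∈ interior (univ : Set ℝ) := by simp
  have hy : y ∈ interior (univ : Set ℝ) := by simp
  exact (hc.rightDeriv_lt_slope (mem_univ x) (mem_univ y) hxy
    (hc.convexOn.differentiableWithinAt_Ioi_of_mem_interior hx)).trans
    (hc.slope_lt_leftDeriv (mem_univ x) (mem_univ y) hxy
    (hc.convexOn.differentiableWithinAt_Iio_of_mem_interior hy))

lemma le_rightDeriv_iff (hc : ConvexOn ℝ univ c) {x q : ℝ} :
    q ≤ derivWithin c (Ioi x) x ↔ ∀ y, x < y → q ≤ slope c x y := by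
  have hx : x ∈ interior (univ : Set ℝ) := by simp
  constructor
  · intro h y hy
    exact h.trans (hc.rightDeriv_le_slope_of_mem_interior hx (mem_univ y) hy)
  · intro h
    rw [hc.rightDeriv_eq_sInf_slope_of_mem_interior hx]
    refine le_csInf ⟨_, mem_image_of_mem _ ⟨mem_univ (x + 1), lt_add_one x⟩⟩ ?_
    rintro _ ⟨y, ⟨-, hy⟩, rfl⟩
    exact h y hy

/-- Slopes increase towards `x`, so testing points in `[y₀, x)` suffices; `y₀` will be the boundary
of the constraint set. -/
lemma leftDeriv_le_iff (hc : ConvexOn ℝ univ c) {x y₀ q : ℝ} (hy₀ : y₀ < x) :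
    derivWithin c (Iio x) x ≤ q ↔ ∀ y, y₀ ≤ y → y < x → slope c x y ≤ q := by
  have hx : x ∈ interior (univ : Set ℝ) := by simp
  constructor
  · intro h y _ hy
    rw [slope_comm]
    exact (hc.slope_le_leftDeriv_of_mem_interior (mem_univ y) hx hy).trans h
  · intro h
    rw [hc.leftDeriv_eq_sSup_slope_of_mem_interior hx]
    refine csSup_le ⟨_, mem_image_of_mem _ ⟨mem_univ (x - 1), sub_one_lt x⟩⟩ ?_
    rintro _ ⟨y, ⟨-, hy⟩, rfl⟩
    refine le_trans ?_ (h (max y y₀) (le_max_right _ _) (max_lt hy hy₀))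
    exact hc.slope_mono (mem_univ x) ⟨mem_univ _, hy.ne⟩ ⟨mem_univ _, (max_lt hy hy₀).ne⟩
      (le_max_left _ _)

/-- First-order conditions for minimizing a convex cost minus linear revenue on `[0, ∞)`. -/
lemma isMinOn_cost_iff (hc : ConvexOn ℝ univ c) (r q d : ℝ) {b : ℝ} (hb : 0 ≤ b) :
    IsMinOn (fun b => b * (r - q) + c (b - d)) (Ici 0) b ↔
      q ≤ derivWithin c (Ioi (b - d)) (b - d) + r ∧
        (0 < b → derivWithin c (Iio (b - d)) (b - d) + r ≤ q) := by
  have hright : q ≤ derivWithin c (Ioi (b - d)) (b - d) + r ↔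
      ∀ y, b < y → b * (r - q) + c (b - d) ≤ y * (r - q) + c (y - d) := by
    rw [← sub_le_iff_le_add, le_rightDeriv_iff hc]
    constructor
    · intro h y hy
      have := h (y - d) (by linarith)
      rw [slope_def_field, le_div_iff₀ (by linarith)] at this
      linarith
    · intro h y hy
      rw [slope_def_field, le_div_iff₀ (by linarith)]
      have := h (y + d) (by linarith)
      rw [add_sub_cancel_right] at this
      linarith
  have hleft : 0 < b → (derivWithin c (Iio (b - d)) (b - d) + r ≤ q ↔
      ∀ y, 0 ≤ y → y < b → b * (r - q) + c (b - d) ≤ y * (r - q) + c (y - d)) := by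
    intro hb
    rw [← le_sub_iff_add_le, leftDeriv_le_iff hc (y₀ := -d) (by linarith)]
    constructor
    · intro h y hy0 hy
      have := h (y - d) (by linarith) (by linarith)
      rw [slope_comm, slope_def_field, div_le_iff₀ (by linarith)] at this
      linarith
    · intro h y hy0 hy
      rw [slope_comm, slope_def_field, div_le_iff₀ (by linarith)]
      have := h (y + d) (by linarith) (by linarith)
      rw [add_sub_cancel_right] at this
      linarith
  rw [isMinOn_iff, hright]
  constructor
  · intro h
    exact ⟨fun y hy => h y (hb.trans hy.le), fun hb => (hleft hb).2 fun y hy _ => h y hy⟩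
  · rintro ⟨h1, h2⟩ y hy
    rcases lt_trichotomy y b with hyb | rfl | hyb
    · have hb' : 0 < b := lt_of_le_of_lt hy hyb
      exact (hleft hb').1 (h2 hb') y hy hyb
    · exact le_rfl
    · exact h1 y hyb

/-- Two minimizers `b < b'` would give `q ≤ L⁺(b - d) < L⁻(b' - d) ≤ q`. This is what makes agents
of one type hold equal amounts. -/
lemma isMinOn_cost_unique (hc : StrictConvexOn ℝ univ c) (r q d : ℝ) {b b' : ℝ} (hb : 0 ≤ b)
    (hb' : 0 ≤ b') (h : IsMinOn (fun b => b * (r - q) + c (b - d)) (Ici 0) b)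
    (h' : IsMinOn (fun b => b * (r - q) + c (b - d)) (Ici 0) b') : b = b' := by
  rw [isMinOn_cost_iff hc.convexOn r q d hb] at h
  rw [isMinOn_cost_iff hc.convexOn r q d hb'] at h'
  rcases lt_trichotomy b b' with hlt | heq | hlt
  · have h1 := h'.2 (hb.trans_lt hlt)
    have h2 := rightDeriv_lt_leftDeriv hc (sub_lt_sub_right hlt d)
    linarith [h.1]
  · exact heq
  · have h1 := h.2 (hb'.trans_lt hlt)
    have h2 := rightDeriv_lt_leftDeriv hc (sub_lt_sub_right hlt d)
    linarith [h'.1]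

lemma IsCostFunction.differentiableAt (hc : IsCostFunction c) {x : ℝ} (hx : x ≠ 0) :
    DifferentiableAt ℝ c x :=
  (hc.2.2.2.contDiffAt (isOpen_compl_singleton.mem_nhds hx)).differentiableAt (by simp)

lemma IsCostFunction.rightDeriv_eq (hc : IsCostFunction c) {x : ℝ} (hx : x ≠ 0) :
    derivWithin c (Ioi x) x = deriv c x :=
  (hc.differentiableAt hx).derivWithin (uniqueDiffWithinAt_Ioi x)

lemma IsCostFunction.leftDeriv_eq (hc : IsCostFunction c) {x : ℝ} (hx : x ≠ 0) :
    derivWithin c (Iio x) x = deriv c x :=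
  (hc.differentiableAt hx).derivWithin (uniqueDiffWithinAt_Iio x)

lemma IsCostFunction.continuousOn_deriv (hc : IsCostFunction c) :
    ContinuousOn (deriv c) {0}ᶜ :=
  hc.2.2.2.continuousOn_deriv_of_isOpen isOpen_compl_singleton le_rfl

lemma IsCostFunction.deriv_le_deriv (hc : IsCostFunction c) {x y : ℝ} (hx : x ≠ 0) (hy : y ≠ 0)
    (hxy : x ≤ y) : deriv c x ≤ deriv c y := by
  rcases hxy.eq_or_lt with rfl | hxy
  · exact le_rfl
  · have := rightDeriv_lt_leftDeriv hc.2.2.1 hxy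
    rw [hc.rightDeriv_eq hx, hc.leftDeriv_eq hy] at this
    exact this.le

lemma IsCostFunction.exists_deriv_eq_slope (hc : IsCostFunction c) {x y : ℝ} (hxy : x < y)
    (h0 : 0 ∉ Ioo x y) : ∃ ξ ∈ Ioo x y, deriv c ξ = slope c x y := by
  have hcont : ContinuousOn c univ := hc.2.2.1.convexOn.continuousOn isOpen_univ
  rw [slope_def_field]
  refine _root_.exists_deriv_eq_slope c hxy (hcont.mono (subset_univ _)) fun z hz => ?_
  exact (hc.differentiableAt fun h => h0 (h ▸ hz)).differentiableWithinAt

/-- Some slope from `0` is below `m`; the mean value theorem turns it into a derivative, and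
monotonicity carries the bound down to `0`. It substitutes for continuity of the derivative at the
possible kink. -/
lemma IsCostFunction.exists_deriv_lt (hc : IsCostFunction c) {m : ℝ}
    (hm : derivWithin c (Ioi 0) 0 < m) : ∃ δ > 0, ∀ x, 0 < x → x ≤ δ → deriv c x < m := by
  have h : ∃ y, 0 < y ∧ slope c 0 y < m := by
    by_contra! h
    exact absurd ((le_rightDeriv_iff hc.2.2.1.convexOn).2 h) (not_le.2 hm)
  obtain ⟨y, hy, hlt⟩ := h
  obtain ⟨ξ, hξ, he⟩ := hc.exists_deriv_eq_slope hy (fun h => lt_irrefl _ h.1)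
  refine ⟨ξ, hξ.1, fun x hx hxξ => ?_⟩
  exact (hc.deriv_le_deriv hx.ne' hξ.1.ne' hxξ).trans_lt (he ▸ hlt)

lemma IsCostFunction.exists_lt_deriv (hc : IsCostFunction c) {m : ℝ}
    (hm : m < derivWithin c (Iio 0) 0) : ∃ δ > 0, ∀ x, 0 < x → x ≤ δ → m < deriv c (-x) := by
  have h : ∃ y, y < 0 ∧ m < slope c 0 y := by
    by_contra! h
    exact absurd ((leftDeriv_le_iff hc.2.2.1.convexOn neg_one_lt_zero).2 fun y _ hy => h y hy)
      (not_le.2 hm)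
  obtain ⟨y, hy, hlt⟩ := h
  obtain ⟨ξ, hξ, he⟩ := hc.exists_deriv_eq_slope hy (fun h => lt_irrefl _ h.2)
  rw [slope_comm] at hlt
  refine ⟨-ξ, neg_pos.2 hξ.2, fun x hx hxξ => ?_⟩
  exact (he ▸ hlt).trans_le (hc.deriv_le_deriv hξ.2.ne (by linarith) (by linarith))

end Cost

/-! ### Tuples with prescribed multiplicities -/

section Counting

/-- The number of indices at which the tuple `κ` takes the value `r`, as a real number. -/
noncomputable def fiberCount {ι α : Type*} [Fintype ι] [DecidableEq α] (κ : ι → α) (r : α) : ℝ :=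
  ∑ j, if κ j = r then (1 : ℝ) else 0

variable {ι α : Type*} [Fintype ι] [DecidableEq α]

lemma fiberCount_eq_card (κ : ι → α) (r : α) :
    fiberCount κ r = (Fintype.card {j // κ j = r} : ℝ) := by
  rw [fiberCount, Finset.sum_boole, Fintype.card_subtype]

lemma sum_fiberCount [Fintype α] (κ : ι → α) : ∑ r, fiberCount κ r = Fintype.card ι := by
  simp only [fiberCount]
  rw [Finset.sum_comm]
  simp

/-- Bijections between fibres of equal size glue to a permutation. -/
lemma isPermutationOf_iff_fiberCount {κ g : ι → α} :
    IsPermutationOf κ g ↔ ∀ r, fiberCount κ r = fiberCount g r := by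
  constructor
  · rintro ⟨σ, hσ⟩ r
    simp only [fiberCount, hσ]
    exact Equiv.sum_comp σ fun j => if g j = r then (1 : ℝ) else 0
  · intro h
    have hcard : ∀ r, Fintype.card {j // κ j = r} = Fintype.card {j // g j = r} := fun r => by
      have := h r
      rw [fiberCount_eq_card, fiberCount_eq_card] at this
      exact_mod_cast this
    exact ⟨Equiv.ofFiberEquiv fun r => Fintype.equivOfCardEq (hcard r),
      fun i => (Equiv.ofFiberEquiv_map _ i).symm⟩

lemma fiberCount_id [Fintype α] (r : α) : fiberCount (fun i : α => i) r = 1 := by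
  simp [fiberCount]

lemma fiberCount_blockIndex {k n : ℕ} (hk : 1 ≤ k) (r : Fin n) :
    fiberCount (blockIndex : Fin (k * n) → Fin n) r = k := by
  rw [fiberCount_eq_card]
  -- Euclidean division: `j = k * r + i` with `i < k`.
  have e : {j : Fin (k * n) // blockIndex j = r} ≃ Fin k :=
    { toFun := fun j => ⟨(j.1 : ℕ) % k, Nat.mod_lt _ hk⟩
      invFun := fun i => ⟨⟨k * r + i, by
        calc k * (r : ℕ) + i < k * r + k := by omega
          _ = k * (r + 1) := by ring
          _ ≤ k * n := Nat.mul_le_mul_left k r.isLt⟩, by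
        ext
        simp only [blockIndex]
        rw [Nat.mul_add_div hk, Nat.div_eq_of_lt i.isLt, add_zero]⟩
      left_inv := by
        rintro ⟨j, rfl⟩
        ext
        simp only [blockIndex]
        exact Nat.div_add_mod _ _
      right_inv := by
        intro i
        ext
        simp [Nat.mod_eq_of_lt i.isLt] }
  rw [Fintype.card_congr e, Fintype.card_fin]

/-- Pigeonhole: `n` fibres, each of size at most one, have total size `n`. -/
lemma fiberCount_eq_one_of_lt_two {n : ℕ} {l : Fin n → Fin n} (h : ∀ r, fiberCount l r < 2)
    (r : Fin n) : fiberCount l r = 1 := by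
  have hle : ∀ r ∈ Finset.univ, fiberCount l r ≤ (fun _ => 1 : Fin n → ℝ) r := fun r _ => by
    have := h r
    show fiberCount l r ≤ 1
    rw [fiberCount_eq_card] at this ⊢
    have h2 : Fintype.card {j // l j = r} < 2 := by exact_mod_cast this
    exact_mod_cast (by omega : Fintype.card {j // l j = r} ≤ 1)
  refine (Finset.sum_eq_sum_iff_of_le hle).1 ?_ r (Finset.mem_univ r)
  rw [sum_fiberCount]; simp

lemma isPermutationOf_comp_iff {β : Type*} {u : ι → β} {e : α → β} {g : ι → α} :
    IsPermutationOf u (fun j => e (g j)) ↔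
      ∃ κ, (∀ r, fiberCount κ r = fiberCount g r) ∧ u = fun j => e (κ j) := by
  constructor
  · rintro ⟨σ, hσ⟩
    exact ⟨fun j => g (σ j), isPermutationOf_iff_fiberCount.1 ⟨σ, fun _ => rfl⟩, funext hσ⟩
  · rintro ⟨κ, hκ, rfl⟩
    obtain ⟨σ, hσ⟩ := isPermutationOf_iff_fiberCount.2 hκ
    exact ⟨σ, fun i => congrArg e (hσ i)⟩

end Counting

/-! ### Characterization of equilibria by first-order conditions -/

section Equilibrium

variable {Ω : Type*} {n m : ℕ} {X : Fin n → Ω → ℝ} {ρI ρE : (Ω → ℝ) → ℝ} {cI cE : ℝ → ℝ}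
  {rI rE a : ℝ}

/-- The equilibria, when the risk of a non-negative exposure is at least proportional to its norm,
with equality only for exposures concentrated at one index. -/
lemma isEquilibrium_iff [NeZero n] [NeZero m]
    (hIsub : ∀ v : Fin n → ℝ, 0 ≤ v → ∀ c : ℝ, ρI (fun ω => dot v (fun j => X j ω) - c)
      = ρI (fun ω => dot v (fun j => X j ω)) - c)
    (hEsub : ∀ v : Fin n → ℝ, 0 ≤ v → ∀ c : ℝ, ρE (fun ω => dot v (fun j => X j ω) - c)
      = ρE (fun ω => dot v (fun j => X j ω)) - c)
    (hIunit : ∀ b : ℝ, 0 ≤ b → ∀ i,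
      ρI (fun ω => dot (unitExposure b i) (fun j => X j ω)) = b * rI)
    (hEunit : ∀ b : ℝ, 0 ≤ b → ∀ i,
      ρE (fun ω => dot (unitExposure b i) (fun j => X j ω)) = b * rE)
    (hIlt : ∀ v : Fin n → ℝ, 0 ≤ v → (∀ i, v ≠ unitExposure (l1norm v) i) →
      l1norm v * rI < ρI (fun ω => dot v (fun j => X j ω)))
    (hElt : ∀ v : Fin n → ℝ, 0 ≤ v → (∀ i, v ≠ unitExposure (l1norm v) i) →
      l1norm v * rE < ρE (fun ω => dot v (fun j => X j ω)))
    (hcI : StrictConvexOn ℝ univ cI) (hcE : StrictConvexOn ℝ univ cE) (ha : 0 < a)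
    {p : Fin n → ℝ} (hp : 0 ≤ p) {w : Fin n → Fin n → ℝ} {u : Fin m → Fin n → ℝ} :
    IsEquilibrium X ρI ρE cI cE a p w u ↔
      ∃ (q s t : ℝ) (κ : Fin m → Fin n) (l : Fin n → Fin n),
        (0 ≤ s ∧ 0 ≤ t ∧ p = (fun _ => q) ∧ u = (fun j => unitExposure s (κ j)) ∧
          w = (fun i => unitExposure t (l i)) ∧
          ∀ r, s * fiberCount κ r + t * fiberCount l r = a) ∧
        (q ≤ derivWithin cE (Ioi s) s + rE ∧ (0 < s → derivWithin cE (Iio s) s + rE ≤ q)) ∧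
        (q ≤ derivWithin cI (Ioi (t - a)) (t - a) + rI ∧
          (0 < t → derivWithin cI (Iio (t - a)) (t - a) + rI ≤ q)) := by
  -- Up to the constant `a * p i`, all internal agents minimize the same function.
  have hobjI : ∀ i (v : Fin n → ℝ), 0 ≤ v →
      ρI (internalLoss X a i v p) + cI (l1norm v - l1norm (unitExposure a i))
        = (ρI (fun ω => dot v (fun j => X j ω)) - dot v p + cI (l1norm v - a)) + a * p i := by
    intro i v hv
    rw [l1norm_unitExposure ha.le]
    have h : internalLoss X a i v p
        = fun ω => dot v (fun j => X j ω) - dot (v - unitExposure a i) p := rfl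
    rw [h, hIsub v hv, dot_sub, dot_unitExposure]
    ring
  have hobjE : ∀ v : Fin n → ℝ, 0 ≤ v →
      ρE (externalLoss X v p) + cE (l1norm v)
        = ρE (fun ω => dot v (fun j => X j ω)) - dot v p + cE (l1norm v - 0) := by
    intro v hv
    have h : externalLoss X v p = fun ω => dot v (fun j => X j ω) - dot v p := rfl
    rw [h, hEsub v hv, sub_zero]
  have hminI : ∀ i (v₀ : Fin n → ℝ), 0 ≤ v₀ → (IsMinOn (fun v =>
      ρI (internalLoss X a i v p) + cI (l1norm v - l1norm (unitExposure a i))) {v | 0 ≤ v} v₀ ↔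
      IsMinOn (fun v => ρI (fun ω => dot v (fun j => X j ω)) - dot v p + cI (l1norm v - a))
        {v | 0 ≤ v} v₀) := by
    intro i v₀ hv₀
    simp only [isMinOn_iff, mem_ofPred_eq]
    refine forall₂_congr fun v hv => ?_
    rw [hobjI i v hv, hobjI i v₀ hv₀, add_le_add_iff_right]
  have hminE : ∀ (v₀ : Fin n → ℝ), 0 ≤ v₀ → (IsMinOn (fun v =>
      ρE (externalLoss X v p) + cE (l1norm v)) {v | 0 ≤ v} v₀ ↔
      IsMinOn (fun v => ρE (fun ω => dot v (fun j => X j ω)) - dot v p + cE (l1norm v - 0))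
        {v | 0 ≤ v} v₀) := by
    intro v₀ hv₀
    simp only [isMinOn_iff, mem_ofPred_eq]
    refine forall₂_congr fun v hv => ?_
    rw [hobjE v hv, hobjE v₀ hv₀]
  have hclear : ∀ (s t : ℝ) (κ : Fin m → Fin n) (l : Fin n → Fin n),
      (∑ i, unitExposure t (l i) + ∑ j, unitExposure s (κ j) = ∑ i : Fin n, unitExposure a i) ↔
        ∀ r, s * fiberCount κ r + t * fiberCount l r = a := by
    intro s t κ l
    rw [funext_iff]
    refine forall_congr' fun r => ?_
    have hsum : ∀ {ι : Type} [Fintype ι] (b : ℝ) (f : ι → Fin n),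
        (∑ i, unitExposure b (f i)) r = b * fiberCount f r := by
      intro ι _ b f
      rw [Finset.sum_apply, fiberCount, Finset.mul_sum]
      refine Finset.sum_congr rfl fun i _ => ?_
      simp [unitExposure, Pi.single_apply, eq_comm]
    rw [Pi.add_apply, hsum t l, hsum s κ, hsum a fun i => i, fiberCount_id, mul_one, add_comm]
  constructor
  · intro h
    obtain ⟨i₀, hi₀⟩ := Finite.exists_max p
    have hI := fun i => (isMinOn_risk_iff hIunit hIlt (fun x => cI (x - a)) hi₀ ⟨i₀, rfl⟩).1
      ⟨h.internal_nonneg i, (hminI i _ (h.internal_nonneg i)).1 (h.internal_optimal i)⟩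
    have hE := fun j => (isMinOn_risk_iff hEunit hElt (fun x => cE (x - 0)) hi₀ ⟨i₀, rfl⟩).1
      ⟨h.external_nonneg j, (hminE _ (h.external_nonneg j)).1 (h.external_optimal j)⟩
    choose t ht l hl hlp htmin using hI
    choose s hs κ hκ hκp hsmin using hE
    have ht' : ∀ i, t i = t 0 := fun i =>
      isMinOn_cost_unique hcI _ _ _ (ht i) (ht 0) (htmin i) (htmin 0)
    have hs' : ∀ j, s j = s 0 := fun j =>
      isMinOn_cost_unique hcE _ _ _ (hs j) (hs 0) (hsmin j) (hsmin 0)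
    have hw : w = fun i => unitExposure (t 0) (l i) := funext fun i => by rw [hl i, ht' i]
    have hu : u = fun j => unitExposure (s 0) (κ j) := funext fun j => by rw [hκ j, hs' j]
    have hcl : ∀ r, s 0 * fiberCount κ r + t 0 * fiberCount l r = a := by
      rw [← hclear, ← hw, ← hu]; exact h.clearance
    -- A loss priced below the maximum would be held by nobody, against clearing with `a > 0`.
    have hp' : p = fun _ => p i₀ := by
      funext r
      by_contra hr
      have h1 : s 0 * fiberCount κ r = 0 := by
        rw [fiberCount, Finset.mul_sum]
        refine Finset.sum_eq_zero fun j _ => ?_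
        split_ifs with hj
        · rw [mul_one]
          by_contra hne
          refine hr (hj ▸ hκp j ?_)
          rw [hs' j]
          exact lt_of_le_of_ne (hs 0) (Ne.symm hne)
        · rw [mul_zero]
      have h2 : t 0 * fiberCount l r = 0 := by
        rw [fiberCount, Finset.mul_sum]
        refine Finset.sum_eq_zero fun i _ => ?_
        split_ifs with hi
        · rw [mul_one]
          by_contra hne
          refine hr (hi ▸ hlp i ?_)
          rw [ht' i]
          exact lt_of_le_of_ne (ht 0) (Ne.symm hne)
        · rw [mul_zero]
      have := hcl r
      linarith
    have hsfoc := (isMinOn_cost_iff hcE.convexOn _ _ _ (hs 0)).1 (hsmin 0)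
    rw [sub_zero] at hsfoc
    exact ⟨p i₀, s 0, t 0, κ, l, ⟨hs 0, ht 0, hp', hu, hw, hcl⟩, hsfoc,
      (isMinOn_cost_iff hcI.convexOn _ _ _ (ht 0)).1 (htmin 0)⟩
  · rintro ⟨q, s, t, κ, l, ⟨hs, ht, rfl, rfl, rfl, hcl⟩, hsfoc, htfoc⟩
    have htmin := (isMinOn_cost_iff hcI.convexOn rI q a ht).2 htfoc
    have hsmin := (isMinOn_cost_iff hcE.convexOn rE q 0 hs).2 (by rwa [sub_zero])
    have hI := fun i => (isMinOn_risk_iff hIunit hIlt (fun x => cI (x - a))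
      (p := fun _ => q) (fun _ => le_rfl) ⟨0, rfl⟩).2
      ⟨t, ht, l i, rfl, fun _ => rfl, htmin⟩
    have hE := fun j => (isMinOn_risk_iff hEunit hElt (fun x => cE (x - 0))
      (p := fun _ => q) (fun _ => le_rfl) ⟨0, rfl⟩).2
      ⟨s, hs, κ j, rfl, fun _ => rfl, hsmin⟩
    exact
      { price_nonneg := hp
        internal_nonneg := fun i => (hI i).1
        external_nonneg := fun j => (hE j).1
        internal_optimal := fun i => (hminI i _ (hI i).1).2 (hI i).2
        external_optimal := fun j => (hminE _ (hE j).1).2 (hE j).2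
        clearance := (hclear s t κ l).2 hcl }

/-- Market clearing in a market with `k` external agents per internal agent. -/
lemma eq_sub_of_clearance {n k : ℕ} [NeZero n] {s t a : ℝ} {κ : Fin (k * n) → Fin n}
    {l : Fin n → Fin n} (h : ∀ r, s * fiberCount κ r + t * fiberCount l r = a) :
    t = a - k * s := by
  -- Summing over the losses counts each agent once: `k * n * s + n * t = n * a`.
  have h1 : ∑ r, (s * fiberCount κ r + t * fiberCount l r) = ∑ _r : Fin n, a :=
    Finset.sum_congr rfl fun r _ => h r
  rw [Finset.sum_add_distrib, ← Finset.mul_sum, ← Finset.mul_sum, sum_fiberCount,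
    sum_fiberCount] at h1
  simp only [Fintype.card_fin, Nat.cast_mul, Finset.sum_const, Finset.card_univ,
    nsmul_eq_mul] at h1
  have hn : (n : ℝ) ≠ 0 := Nat.cast_ne_zero.2 (NeZero.ne n)
  have : (n : ℝ) * t = n * (a - k * s) := by linarith
  exact mul_left_cancel₀ hn this

lemma unitExposure_zero (i : Fin n) : unitExposure 0 i = 0 := Pi.single_zero i

end Equilibrium

/-! ### Equilibria in terms of marginal costs -/

section Main

variable {n k : ℕ} {cI cE : ℝ → ℝ} {rI rE a : ℝ}

/-- Existence and uniqueness of the volume of trade equating the marginal costs. -/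
lemma existsUnique_marginal_eq (hk : 1 ≤ k) (hcI : IsCostFunction cI) (hcE : IsCostFunction cE)
    (ha : 0 < a) (h1 : marginal cI rI (-a) ≤ marginal cE rE (a / k))
    (h2 : marginalRightZero cE rE < marginalLeftZero cI rI) :
    ∃! s : ℝ, s ∈ Ioc 0 (a / k) ∧ marginal cE rE s = marginal cI rI (-(k * s)) := by
  have hk0 : (0 : ℝ) < k := by exact_mod_cast hk
  have hak : 0 < a / k := div_pos ha hk0
  unfold marginalRightZero marginalLeftZero at h2
  obtain ⟨m, hm1, hm2⟩ := exists_between h2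
  obtain ⟨δ, hδ, hδ'⟩ := hcE.exists_deriv_lt (m := m - rE) (by linarith)
  obtain ⟨ε, hε, hε'⟩ := hcI.exists_lt_deriv (m := m - rI) (by linarith)
  -- A starting point near `0` where the external marginal cost is below `m` and the internal one
  -- above it; the kink at `0` keeps the intermediate value argument away from `0` itself.
  set s₁ := min (a / k) (min δ (ε / k)) with hs₁
  have hs₁0 : 0 < s₁ := lt_min hak (lt_min hδ (div_pos hε hk0))
  have hs₁a : s₁ ≤ a / k := min_le_left _ _
  have hs₁δ : s₁ ≤ δ := (min_le_right _ _).trans (min_le_left _ _)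
  have hs₁ε : k * s₁ ≤ ε := by
    rw [mul_comm, ← le_div_iff₀ hk0]
    exact (min_le_right _ _).trans (min_le_right _ _)
  let g : ℝ → ℝ := fun s => marginal cE rE s - marginal cI rI (-(k * s))
  have hmono : ∀ x y, 0 < x → x < y → g x < g y := by
    intro x y hx hxy
    have e1 := rightDeriv_lt_leftDeriv hcE.2.2.1 hxy
    rw [hcE.rightDeriv_eq hx.ne', hcE.leftDeriv_eq (hx.trans hxy).ne'] at e1
    have e2 : deriv cI (-(k * y)) ≤ deriv cI (-(k * x)) :=
      hcI.deriv_le_deriv (neg_ne_zero.2 (mul_pos hk0 (hx.trans hxy)).ne')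
        (neg_ne_zero.2 (mul_pos hk0 hx).ne') (neg_le_neg (by gcongr))
    simp only [g, marginal]
    linarith
  have hcont : ContinuousOn g (Icc s₁ (a / k)) := by
    have c1 : ContinuousOn (deriv cE) (Icc s₁ (a / k)) :=
      hcE.continuousOn_deriv.mono fun x hx => (hs₁0.trans_le hx.1).ne'
    have c2 : ContinuousOn (fun s : ℝ => deriv cI (-(k * s))) (Icc s₁ (a / k)) :=
      hcI.continuousOn_deriv.comp (by fun_prop) fun x hx =>
        neg_ne_zero.2 (mul_pos hk0 (hs₁0.trans_le hx.1)).ne'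
    exact (c1.add continuousOn_const).sub (c2.add continuousOn_const)
  have hg1 : g s₁ ≤ 0 := by
    have e1 := hδ' s₁ hs₁0 hs₁δ
    have e2 := hε' (k * s₁) (mul_pos hk0 hs₁0) hs₁ε
    simp only [g, marginal]
    linarith
  have hg2 : 0 ≤ g (a / k) := by
    have : (k : ℝ) * (a / k) = a := by field_simp
    simp only [g, this]
    linarith
  obtain ⟨s, hs, hgs⟩ := intermediate_value_Icc hs₁a hcont ⟨hg1, hg2⟩
  refine ⟨s, ⟨⟨hs₁0.trans_le hs.1, hs.2⟩, sub_eq_zero.1 hgs⟩, ?_⟩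
  rintro s' ⟨hs', he⟩
  have hgs' : g s' = 0 := sub_eq_zero.2 he
  rcases lt_trichotomy s' s with hlt | heq | hlt
  · have := hmono _ _ hs'.1 hlt; linarith
  · exact heq
  · have := hmono _ _ (hs₁0.trans_le hs.1) hlt; linarith

/-- The first-order conditions when the external agents take over all losses. -/
lemma firstOrder_iff_full (hk : 1 ≤ k) (hcI : IsCostFunction cI) (hcE : IsCostFunction cE)
    (ha : 0 < a) (h : marginal cE rE (a / k) < marginal cI rI (-a)) {q s t : ℝ}
    (ht : 0 ≤ t) (hts : t = a - k * s) :
    ((q ≤ derivWithin cE (Ioi s) s + rE ∧ (0 < s → derivWithin cE (Iio s) s + rE ≤ q)) ∧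
      (q ≤ derivWithin cI (Ioi (t - a)) (t - a) + rI ∧
        (0 < t → derivWithin cI (Iio (t - a)) (t - a) + rI ≤ q))) ↔
      s = a / k ∧ q = marginal cE rE (a / k) := by
  have hk0 : (0 : ℝ) < k := by exact_mod_cast hk
  have hak : 0 < a / k := div_pos ha hk0
  have hka : (k : ℝ) * (a / k) = a := by field_simp
  unfold marginal at h ⊢
  constructor
  · rintro ⟨⟨e1, e2⟩, i1, i2⟩
    have hs : s = a / k := by
      -- Otherwise `t > 0`, and `q ≤ L_E⁺(s) < L_E(a / k) < L_I(-a) < L_I⁻(t - a) ≤ q`.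
      by_contra hne
      have htne : t ≠ 0 := fun h0 => hne (by rw [eq_div_iff hk0.ne']; linarith)
      have htpos : 0 < t := lt_of_le_of_ne ht htne.symm
      have hsa : s < a / k := by rw [lt_div_iff₀ hk0]; linarith
      have h1 := rightDeriv_lt_leftDeriv hcE.2.2.1 hsa
      have h2 := rightDeriv_lt_leftDeriv hcI.2.2.1 (show -a < t - a by linarith)
      rw [hcE.leftDeriv_eq hak.ne'] at h1
      rw [hcI.rightDeriv_eq (neg_ne_zero.2 ha.ne')] at h2
      linarith [i2 htpos]
    subst hs
    rw [hcE.rightDeriv_eq hak.ne'] at e1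
    rw [hcE.leftDeriv_eq hak.ne'] at e2
    exact ⟨rfl, le_antisymm e1 (e2 hak)⟩
  · rintro ⟨rfl, rfl⟩
    have ht0 : t = 0 := by rw [hts, hka, sub_self]
    rw [ht0, zero_sub, hcE.rightDeriv_eq hak.ne', hcE.leftDeriv_eq hak.ne',
      hcI.rightDeriv_eq (neg_ne_zero.2 ha.ne')]
    exact ⟨⟨le_rfl, fun _ => le_rfl⟩, h.le, fun h0 => absurd h0 (lt_irrefl _)⟩

/-- The first-order conditions when the external agents take over a part of the losses. -/
lemma firstOrder_iff_partial (hk : 1 ≤ k) (hcI : IsCostFunction cI) (hcE : IsCostFunction cE)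
    (ha : 0 < a) (h1 : marginal cI rI (-a) ≤ marginal cE rE (a / k))
    (h2 : marginalRightZero cE rE < marginalLeftZero cI rI) {s₀ : ℝ} (hs₀ : s₀ ∈ Ioc 0 (a / k))
    (heq : marginal cE rE s₀ = marginal cI rI (-(k * s₀))) {q s t : ℝ} (hs : 0 ≤ s)
    (ht : 0 ≤ t) (hts : t = a - k * s) :
    ((q ≤ derivWithin cE (Ioi s) s + rE ∧ (0 < s → derivWithin cE (Iio s) s + rE ≤ q)) ∧
      (q ≤ derivWithin cI (Ioi (t - a)) (t - a) + rI ∧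
        (0 < t → derivWithin cI (Iio (t - a)) (t - a) + rI ≤ q))) ↔
      s = s₀ ∧ q = marginal cE rE s₀ := by
  have hk0 : (0 : ℝ) < k := by exact_mod_cast hk
  have hta : t - a = -(k * s) := by rw [hts]; ring
  rw [hta]
  have hfoc : 0 < s → (((q ≤ derivWithin cE (Ioi s) s + rE ∧
      (0 < s → derivWithin cE (Iio s) s + rE ≤ q)) ∧
      (q ≤ derivWithin cI (Ioi (-(k * s))) (-(k * s)) + rI ∧
        (0 < t → derivWithin cI (Iio (-(k * s))) (-(k * s)) + rI ≤ q))) ↔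
      q = marginal cE rE s ∧ q ≤ marginal cI rI (-(k * s)) ∧
        (0 < t → marginal cI rI (-(k * s)) ≤ q)) := by
    intro hs0
    have hks : -(k * s) ≠ 0 := neg_ne_zero.2 (mul_pos hk0 hs0).ne'
    rw [hcE.rightDeriv_eq hs0.ne', hcE.leftDeriv_eq hs0.ne', hcI.rightDeriv_eq hks,
      hcI.leftDeriv_eq hks]
    exact ⟨fun h => ⟨le_antisymm h.1.1 (h.1.2 hs0), h.2⟩,
      fun h => ⟨⟨h.1.le, fun _ => h.1.ge⟩, h.2⟩⟩
  constructor
  · intro h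
    have hs0 : 0 < s := by
      -- Without trade, `t = a > 0` and `q ≤ L_E⁺(0) < L_I⁻(0) ≤ q`.
      refine lt_of_le_of_ne hs fun h0 => ?_
      subst h0
      have ht0 : 0 < t := by rw [hts]; simpa using ha
      have e1 := h.1.1
      have i2 := h.2.2 ht0
      rw [mul_zero, neg_zero] at i2
      unfold marginalRightZero marginalLeftZero at h2
      linarith
    obtain ⟨hq, i1, i2⟩ := (hfoc hs0).1 h
    have hsa : s ≤ a / k := by rw [le_div_iff₀ hk0]; linarith
    have he : marginal cE rE s = marginal cI rI (-(k * s)) := by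
      -- At the corner `t = 0` the internal condition is one-sided; `h1` supplies the other
      -- inequality.
      rcases ht.eq_or_lt with ht0 | ht0
      · have hsk : s = a / k := by rw [eq_div_iff hk0.ne']; linarith
        have hks : -(k * s) = -a := by linarith
        rw [hks] at i1 ⊢
        rw [← hsk] at h1
        linarith
      · linarith [i2 ht0]
    obtain ⟨_, -, huniq⟩ := existsUnique_marginal_eq hk hcI hcE ha h1 h2
    have hss : s = s₀ := (huniq s ⟨⟨hs0, hsa⟩, he⟩).trans (huniq s₀ ⟨hs₀, heq⟩).symm
    exact ⟨hss, hss ▸ hq⟩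
  · rintro ⟨rfl, rfl⟩
    exact (hfoc hs₀.1).2 ⟨rfl, heq.le, fun _ => heq.ge⟩

/-- The first-order conditions when there is no trade. -/
lemma firstOrder_iff_none (hk : 1 ≤ k) (hcI : IsCostFunction cI) (hcE : IsCostFunction cE)
    (ha : 0 < a) (h : marginalLeftZero cI rI ≤ marginalRightZero cE rE) {q s t : ℝ} (hs : 0 ≤ s)
    (hts : t = a - k * s) :
    ((q ≤ derivWithin cE (Ioi s) s + rE ∧ (0 < s → derivWithin cE (Iio s) s + rE ≤ q)) ∧
      (q ≤ derivWithin cI (Ioi (t - a)) (t - a) + rI ∧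
        (0 < t → derivWithin cI (Iio (t - a)) (t - a) + rI ≤ q))) ↔
      s = 0 ∧ q ∈ Icc (marginalLeftZero cI rI)
        (min (marginalRightZero cE rE) (marginalRightZero cI rI)) := by
  have hk0 : (0 : ℝ) < k := by exact_mod_cast hk
  rw [mem_Icc, le_min_iff]
  unfold marginalLeftZero marginalRightZero at *
  have hzero : s = 0 → t - a = 0 ∧ 0 < t := by
    rintro rfl
    rw [hts]
    simpa using ha
  constructor
  · rintro ⟨⟨e1, e2⟩, i1, i2⟩
    have hs0 : s = 0 := by
      -- With trade, `q ≤ L_I⁺(t - a) < L_I⁻(0) ≤ L_E⁺(0) < L_E⁻(s) ≤ q`.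
      by_contra hne
      have hspos : 0 < s := lt_of_le_of_ne hs (Ne.symm hne)
      have h1 := rightDeriv_lt_leftDeriv hcE.2.2.1 hspos
      have h2 := rightDeriv_lt_leftDeriv hcI.2.2.1
        (show t - a < 0 by have := mul_pos hk0 hspos; linarith)
      linarith [e2 hspos]
    obtain ⟨h0, ht0⟩ := hzero hs0
    rw [h0] at i1 i2
    rw [hs0] at e1
    exact ⟨hs0, i2 ht0, e1, i1⟩
  · rintro ⟨hs0, h1, h2, h3⟩
    rw [(hzero hs0).1, hs0]
    exact ⟨⟨h2, fun h0 => absurd h0 (lt_irrefl _)⟩, h3, fun _ => h1⟩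

end Main

end SuperParetoMarket

theorem mainTheorem2
    {Ω : Type*} [MeasurableSpace Ω] (μ : Measure Ω) [IsProbabilityMeasure μ]
    (n k : ℕ) (hn : 2 ≤ n) (hk : 1 ≤ k)
    -- the losses `X₁, …, Xₙ` are WNAID super-Pareto with a continuous distribution,
    -- and `X₀` is a generic copy of them
    (X : Fin n → Ω → ℝ) (X₀ : Ω → ℝ)
    (hXmeas : ∀ i, Measurable (X i)) (hX₀meas : Measurable X₀)
    (hident : ∀ i, IdentDistrib (X i) X₀ μ μ)
    (hwna : WeaklyNegativelyAssociated μ X)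
    (hsp : IsSuperPareto μ X₀)
    (hcont : ∀ x : ℝ, μ {ω | X₀ ω = x} = 0)
    -- the set `𝒳` of random variables on which the risk measures are defined
    (𝒳 : Set (Ω → ℝ))
    (h𝒳meas : ∀ Y ∈ 𝒳, Measurable Y)
    (h𝒳cone : ∀ v : Fin n → ℝ, 0 ≤ v → ∀ c : ℝ, (fun ω => dot v (fun j => X j ω) + c) ∈ 𝒳)
    (h𝒳law : ∀ θ ∈ stdSimplex ℝ (Fin n), ∀ Y : Ω → ℝ, Measurable Y →
      IdentDistrib Y (fun ω => dot θ (fun j => X j ω)) μ μ → Y ∈ 𝒳)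
    -- risk measures and costs of the internal and of the external agents
    (ρI ρE : (Ω → ℝ) → ℝ)
    (hρI : IsDistortionRiskMeasure μ 𝒳 ρI) (hρI' : MildlyMonotone μ 𝒳 ρI)
    (hρE : IsDistortionRiskMeasure μ 𝒳 ρE) (hρE' : MildlyMonotone μ 𝒳 ρE)
    (cI cE : ℝ → ℝ) (hcI : IsCostFunction cI) (hcE : IsCostFunction cE)
    (a : ℝ) (ha : 0 < a) :
    -- (i)
    (marginal cE (ρE X₀) (a / k) < marginal cI (ρI X₀) (-a) →
      ∀ (p : Fin n → ℝ) (w : Fin n → Fin n → ℝ) (u : Fin (k * n) → Fin n → ℝ), 0 ≤ p →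
        (IsEquilibrium X ρI ρE cI cE a p w u ↔
          p = (fun _ => marginal cE (ρE X₀) (a / k)) ∧
          IsPermutationOf u (fun j => unitExposure (a / k) (blockIndex j)) ∧
          w = 0)) ∧
    -- (ii)
    (marginal cI (ρI X₀) (-a) ≤ marginal cE (ρE X₀) (a / k) →
      marginalRightZero cE (ρE X₀) < marginalLeftZero cI (ρI X₀) →
      (∃! s : ℝ, s ∈ Ioc 0 (a / k) ∧
        marginal cE (ρE X₀) s = marginal cI (ρI X₀) (-(k * s))) ∧
      ∀ s : ℝ, s ∈ Ioc 0 (a / k) →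
        marginal cE (ρE X₀) s = marginal cI (ρI X₀) (-(k * s)) →
        ∀ (p : Fin n → ℝ) (w : Fin n → Fin n → ℝ) (u : Fin (k * n) → Fin n → ℝ), 0 ≤ p →
          (IsEquilibrium X ρI ρE cI cE a p w u ↔
            p = (fun _ => marginal cE (ρE X₀) s) ∧
            ∃ (κ : Fin (k * n) → Fin n) (l : Fin n → Fin n),
              u = (fun j => unitExposure s (κ j)) ∧
              w = (fun i => unitExposure (a - k * s) (l i)) ∧
              ∀ r : Fin n,
                s * (∑ j, if κ j = r then (1 : ℝ) else 0)
                  + (a - k * s) * (∑ i, if l i = r then (1 : ℝ) else 0) = a) ∧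
          (s < a / (2 * k) →
            (IsEquilibrium X ρI ρE cI cE a p w u ↔
              p = (fun _ => marginal cE (ρE X₀) s) ∧
              IsPermutationOf u (fun j => unitExposure s (blockIndex j)) ∧
              IsPermutationOf w (fun i => unitExposure (a - k * s) i)))) ∧
    -- (iii)
    (marginalLeftZero cI (ρI X₀) ≤ marginalRightZero cE (ρE X₀) →
      ∀ (p : Fin n → ℝ) (w : Fin n → Fin n → ℝ) (u : Fin (k * n) → Fin n → ℝ), 0 ≤ p →
        (IsEquilibrium X ρI ρE cI cE a p w u ↔
          (∃ q : ℝ, p = (fun _ => q) ∧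
            q ∈ Icc (marginalLeftZero cI (ρI X₀))
              (min (marginalRightZero cE (ρE X₀)) (marginalRightZero cI (ρI X₀)))) ∧
          u = 0 ∧
          IsPermutationOf w (fun i => unitExposure a i))) := by
  have : NeZero n := ⟨by omega⟩
  have : NeZero (k * n) := ⟨Nat.mul_ne_zero (by omega) (by omega)⟩
  have hk0 : (0 : ℝ) < k := by exact_mod_cast hk
  have hka : (k : ℝ) * (a / k) = a := by field_simp
  have char := fun {p : Fin n → ℝ} {w : Fin n → Fin n → ℝ} {u : Fin (k * n) → Fin n → ℝ}
      (hp : 0 ≤ p) => isEquilibrium_iff (p := p) (w := w) (u := u)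
    (fun v hv c => risk_dot_sub h𝒳cone hρI hv c)
    (fun v hv c => risk_dot_sub h𝒳cone hρE hv c)
    (fun b hb i => (risk_unitExposure hX₀meas hident h𝒳cone h𝒳law hρI hρI' hb i).2)
    (fun b hb i => (risk_unitExposure hX₀meas hident h𝒳cone h𝒳law hρE hρE' hb i).2)
    (fun v hv h => l1norm_mul_lt_risk hXmeas hX₀meas hident hwna hsp hcont h𝒳cone h𝒳law
      hρI hρI' hv h)
    (fun v hv h => l1norm_mul_lt_risk hXmeas hX₀meas hident hwna hsp hcont h𝒳cone h𝒳law
      hρE hρE' hv h)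
    hcI.2.2.1 hcE.2.2.1 ha hp
  refine ⟨fun h p w u hp => ?_, fun h1 h2 => ?_, fun h p w u hp => ?_⟩
  · rw [char hp, isPermutationOf_comp_iff]
    simp only [fiberCount_blockIndex hk]
    constructor
    · rintro ⟨q, s, t, κ, l, ⟨hs, ht, rfl, rfl, rfl, hcl⟩, hfoc⟩
      have hts := eq_sub_of_clearance hcl
      obtain ⟨rfl, rfl⟩ := (firstOrder_iff_full hk hcI hcE ha h ht hts).1 hfoc
      have ht0 : t = 0 := by rw [hts, hka, sub_self]
      subst ht0
      refine ⟨rfl, ⟨κ, fun r => ?_, rfl⟩, funext fun i => unitExposure_zero _⟩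
      have := hcl r
      rw [zero_mul, add_zero, div_mul_eq_mul_div, div_eq_iff hk0.ne'] at this
      exact mul_left_cancel₀ ha.ne' this
    · rintro ⟨rfl, ⟨κ, hκ, rfl⟩, rfl⟩
      -- The internal exposures vanish, so their assignment to losses is arbitrary; `id` serves.
      refine ⟨_, a / k, 0, κ, id, ⟨(div_pos ha hk0).le, le_rfl, rfl, rfl,
        funext fun i => (unitExposure_zero _).symm, fun r => ?_⟩,
        (firstOrder_iff_full hk hcI hcE ha h le_rfl (by rw [hka, sub_self])).2 ⟨rfl, rfl⟩⟩
      rw [hκ, zero_mul, add_zero, mul_comm, hka]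
  · refine ⟨existsUnique_marginal_eq hk hcI hcE ha h1 h2, fun s hs heq p w u hp => ?_⟩
    have hks : 0 ≤ a - k * s := by
      have := mul_le_mul_of_nonneg_left hs.2 hk0.le
      linarith
    have main : IsEquilibrium X ρI ρE cI cE a p w u ↔
        p = (fun _ => marginal cE (ρE X₀) s) ∧
          ∃ (κ : Fin (k * n) → Fin n) (l : Fin n → Fin n),
            u = (fun j => unitExposure s (κ j)) ∧
            w = (fun i => unitExposure (a - k * s) (l i)) ∧
            ∀ r : Fin n, s * fiberCount κ r + (a - k * s) * fiberCount l r = a := by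
      rw [char hp]
      constructor
      · rintro ⟨q, s', t, κ, l, ⟨hs', ht, rfl, rfl, rfl, hcl⟩, hfoc⟩
        have hts := eq_sub_of_clearance hcl
        obtain ⟨rfl, rfl⟩ :=
          (firstOrder_iff_partial hk hcI hcE ha h1 h2 hs heq hs' ht hts).1 hfoc
        subst hts
        exact ⟨rfl, κ, l, rfl, rfl, hcl⟩
      · rintro ⟨rfl, κ, l, rfl, rfl, hcl⟩
        exact ⟨_, s, a - k * s, κ, l, ⟨hs.1.le, hks, rfl, rfl, rfl, hcl⟩,
          (firstOrder_iff_partial hk hcI hcE ha h1 h2 hs heq hs.1.le hks rfl).2 ⟨rfl, rfl⟩⟩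
    refine ⟨main, fun hlt => ?_⟩
    rw [main, isPermutationOf_comp_iff,
      isPermutationOf_comp_iff (e := unitExposure (a - k * s)) (g := fun i : Fin n => i)]
    simp only [fiberCount_blockIndex hk, fiberCount_id]
    refine and_congr_right fun _ => ⟨?_, ?_⟩
    · rintro ⟨κ, l, rfl, rfl, hcl⟩
      -- Two internal agents on one loss would together exceed the supply `a`; hence each loss has
      -- exactly one internal holder.
      have hlt' : a < (a - k * s) * 2 := by
        rw [lt_div_iff₀ (by positivity)] at hlt
        linarith
      have hl : ∀ r, fiberCount l r = 1 := fiberCount_eq_one_of_lt_two fun r => by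
        have hκ0 : 0 ≤ s * fiberCount κ r := by
          rw [fiberCount_eq_card]
          exact mul_nonneg hs.1.le (Nat.cast_nonneg _)
        have := hcl r
        exact lt_of_mul_lt_mul_left (by linarith) hks
      refine ⟨⟨κ, fun r => ?_, rfl⟩, l, hl, rfl⟩
      have := hcl r
      rw [hl] at this
      exact mul_left_cancel₀ hs.1.ne' (by linarith)
    · rintro ⟨⟨κ, hκ, rfl⟩, l, hl, rfl⟩
      exact ⟨κ, l, rfl, rfl, fun r => by rw [hκ, hl]; ring⟩
  · rw [char hp, isPermutationOf_comp_iff (e := unitExposure a) (g := fun i : Fin n => i)]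
    simp only [fiberCount_id]
    constructor
    · rintro ⟨q, s, t, κ, l, ⟨hs, ht, rfl, rfl, rfl, hcl⟩, hfoc⟩
      have hts := eq_sub_of_clearance hcl
      obtain ⟨rfl, hq⟩ := (firstOrder_iff_none hk hcI hcE ha h hs hts).1 hfoc
      rw [mul_zero, sub_zero] at hts
      subst hts
      refine ⟨⟨q, rfl, hq⟩, funext fun j => unitExposure_zero _, l, fun r => ?_, rfl⟩
      have := hcl r
      rw [zero_mul, zero_add] at this
      exact mul_left_cancel₀ ha.ne' (by rw [this, mul_one])
    · rintro ⟨⟨q, rfl, hq⟩, rfl, l, hl, rfl⟩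
      -- External exposures vanish, so the constant assignment is as good as any.
      refine ⟨q, 0, a, fun _ => 0, l, ⟨le_rfl, ha.le, rfl,
        funext fun j => (unitExposure_zero _).symm, rfl, fun r => ?_⟩,
        (firstOrder_iff_none hk hcI hcE ha h le_rfl (by ring)).2 ⟨rfl, hq⟩⟩
      rw [hl, zero_mul, zero_add, mul_one]
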